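/- For a random variable $X$ with distribution function $F$ let $F^{-1}(u)=\inf\{x:F(x)\ge u\}$, $0<u<1$, and put $L(u)=-\log(1-u)$. Let $U_1<U_2<\cdots$ be the successive (upper) record values of an i.i.d. sequence of uniform random variables on $(0,1)$, put $R_n=F^{-1}(U_n)$, $w_n=\mathbb{E}|R_n|$, and let $\rho_n=\mathbb{E}R_n$ be the expected record sequence of $X$ (whenever these are finite). Random variables with the same distribution are identified. Let $\mathcal H^*$ be the set of all non-constant, non-decreasing, left-continuous $H:(0,\infty)\to\mathbb R$ with $\int_0^\infty y^m e^{-y}|H(y)|\,dy<\infty$ for $m=0,1,2,\dots$, and let $\mathcal H_0$ be the set of those $H\in\mathcal H^*$ with $\int_0^\infty e^{-y}H(y)\,dy=0$ and $\int_0^\infty ye^{-y}H(y)\,dy=1$. A random variable belongs to $\mathcal H^*$ (to $\mathcal H_0$) if its inverse distribution function is $u\mapsto H(L(u))$, $0<u<1$, for some $H$ in $\mathcal H^*$ (in $\mathcal H_0$). Let $\mathcal T$ be the set of random variables $T$ with $\Pr(T>0)=1$ and finite moments of every order. For $X\in\mathcal H^*$ let $\varphi(X)$ be (the distribution of) $L(F(V))$,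 where $V$ has Lebesgue density $(1-F(x))L(F(x))\big/\int_{\mathbb R}(1-F(y))L(F(y))\,dy$, with $(1-F(x))L(F(x))=0$ if $F(x)\in\{0,1\}$. For $T\in\mathcal T$ with distribution function $F_T$ let $\varphi^{-1}(T)$ be the random variable with inverse distribution function $u\mapsto H_0(L(u))$, where $$H_0(y)=\frac{e^y}{y}F_T(y-)-\int_1^y\frac{x-1}{x^2}e^xF_T(x)\,dx-c_T,\qquad y>0,$$ and $c_T$ is the constant for which $\int_0^\infty e^{-y}H_0(y)\,dy=0$. **Theorem.** Let $X\in\mathcal H^*$ and $T=\varphi(X)$. Then $\mathbb E|R_n|<\infty$ for all $n$, $\rho_1<\rho_2$ and $T\in\mathcal T$. Let $G_\rho(t)=\sum_{n\ge1}\rho_nt^{n-1}$, $G_w(t)=\sum_{n\ge1}w_nt^{n-1}$ and $M_T(a)=\mathbb E e^{aT}$. The following are equivalent: (i) $\mathbb E(X^+)^p<\infty$ for some $p>1$; (ii) the series $G_\rho(t)$ converges for all $t$ in a neighborhood of zero; (iii) $G_w(t)<\infty$ for some $t>0$; (iv) $M_T(a)<\infty$ for some $a>0$. If these conditions hold, then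 there is $\epsilon_0\in(0,1)$ such that, for $|t|<\epsilon_0$, the series $G_\rho(t)$ converges, $M_T(t)$ is finite, and $$G_\rho(t)=\frac1{1-t}\Big\{\rho_1+(\rho_2-\rho_1)\int_0^tM_T(s)\,ds\Big\},\qquad M_T(t)=\frac1{\rho_2-\rho_1}\,\frac{d}{dt}\Big((1-t)G_\rho(t)\Big).$$ Moreover, $\varphi^{-1}(T)\in\mathcal H_0$ (with inverse distribution function $u\mapsto H_0(L(u))$), $\varphi(\varphi^{-1}(T))=T$, and $X=\rho_1+(\rho_2-\rho_1)\varphi^{-1}(T)$ in distribution. Further, $X$ is characterized by $G_\rho$: the only $T'\in\mathcal T$ whose moment generating function is finite and equal to $\frac1{\rho_2-\rho_1}\frac{d}{dt}((1-t)G_\rho(t))$ near zero is $T'=T$, so that $X=\rho_1+(\rho_2-\rho_1)\varphi^{-1}(T')$ in distribution for every such $T'$; and every $X'\in\mathcal H^*$ for which the generating function of the expected record sequence converges and equals $G_\rho$ near zero has the same distribution as $X$. -/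

import Mathlib

open MeasureTheory ProbabilityTheory Set Filter Topology

namespace RecordSeq

noncomputable section

/-- The left-continuous inverse distribution function `F⁻¹(u) = inf {x : F(x) ≥ u}`
(meaningful for `0 < u < 1`) of a probability measure on the line. -/
def invCdf (μ : Measure ℝ) (u : ℝ) : ℝ := sInf {x : ℝ | u ≤ cdf μ x}

/-- `L(u) = -log (1 - u)`. Note `L(0) = 0`, and `L(1) = 0` by the convention `log 0 = 0`. -/
def L (u : ℝ) : ℝ := -Real.log (1 - u)

/-! ### Records -/

/-- Upper record times of a real sequence `y 0, y 1, …`: the first time is the first index, and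
the next one is `inf {m > t : y m > y t}`, where `t` is the current one. Indices start from `0`, so
`recordTime y n` is the time of the `(n+1)`-st record. (The infimum of the empty set, which is `0`,
is only met if the sequence has finitely many records; for i.i.d. uniform variables this has
probability zero.) -/
def recordTime (y : ℕ → ℝ) : ℕ → ℕ
  | 0 => 0
  | n + 1 => sInf {m : ℕ | recordTime y n < m ∧ y (recordTime y n) < y m}

/-- The `(n+1)`-st upper record value of a real sequence. -/
def recordValue (y : ℕ → ℝ) (n : ℕ) : ℝ := y (recordTime y n)

/-- The record process `F⁻¹(U₁), F⁻¹(U₂), …` attached to the law `μ` (with distribution function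
`F`), where `U₁, U₂, …` are the records of the sequence `Y`, meant to be i.i.d. uniform on `(0,1)`.
`record μ Y n` is the `(n+1)`-st term `F⁻¹(U_{n+1})`. -/
def record {S : Type*} (μ : Measure ℝ) (Y : ℕ → S → ℝ) (n : ℕ) (s : S) : ℝ :=
  invCdf μ (recordValue (fun i => Y i s) n)

/-- Expected record sequence: `expRecord μ Y Q n` is `ρ_{n+1} = E R_{n+1}`. -/
def expRecord {S : Type*} [MeasurableSpace S] (μ : Measure ℝ) (Y : ℕ → S → ℝ) (Q : Measure S)
    (n : ℕ) : ℝ :=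
  ∫ s, record μ Y n s ∂Q

/-- `absRecord μ Y Q n` is `w_{n+1} = E |R_{n+1}|`. -/
def absRecord {S : Type*} [MeasurableSpace S] (μ : Measure ℝ) (Y : ℕ → S → ℝ) (Q : Measure S)
    (n : ℕ) : ℝ :=
  ∫ s, |record μ Y n s| ∂Q

/-- The generating function `∑_{n ≥ 1} a_n t^{n-1}`, where `a n` stands for `a_{n+1}`. -/
def genFun (a : ℕ → ℝ) (t : ℝ) : ℝ := ∑' n, a n * t ^ n

/-! ### The spaces of random variables (laws) -/

/-- The functions `H : (0,∞) → ℝ` of the class `H*` (values outside `(0,∞)` play no role). -/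
structure MemHStar (H : ℝ → ℝ) : Prop where
  nonconst : ∃ x ∈ Ioi (0 : ℝ), ∃ y ∈ Ioi (0 : ℝ), H x ≠ H y
  mono : MonotoneOn H (Ioi 0)
  leftCont : ∀ y ∈ Ioi (0 : ℝ), ContinuousWithinAt H (Iio y) y
  integrable : ∀ m : ℕ, IntegrableOn (fun y => y ^ m * Real.exp (-y) * |H y|) (Ioi 0)

/-- The functions of the class `H₀`. -/
structure MemHZero (H : ℝ → ℝ) : Prop extends MemHStar H where
  first : ∫ y in Ioi (0 : ℝ), Real.exp (-y) * H y = 0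
  second : ∫ y in Ioi (0 : ℝ), y * Real.exp (-y) * H y = 1

/-- A law on the line belongs to `H*` if its inverse distribution function is
`u ↦ H (-log (1 - u))` on `(0,1)` for some function `H` in `H*`. -/
def LawHStar (μ : Measure ℝ) : Prop :=
  IsProbabilityMeasure μ ∧ ∃ H : ℝ → ℝ, MemHStar H ∧ ∀ u ∈ Ioo (0 : ℝ) 1, invCdf μ u = H (L u)

/-- A law on the line belongs to `H₀` if its inverse distribution function is
`u ↦ H (-log (1 - u))` on `(0,1)` for some function `H` in `H₀`. -/
def LawHZero (μ : Measure ℝ) : Prop :=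
  IsProbabilityMeasure μ ∧ ∃ H : ℝ → ℝ, MemHZero H ∧ ∀ u ∈ Ioo (0 : ℝ) 1, invCdf μ u = H (L u)

/-- The laws of the random variables `T` with `Pr(T > 0) = 1` and finite moments of any order. -/
structure LawT (ν : Measure ℝ) : Prop where
  prob : IsProbabilityMeasure ν
  pos : ν (Ioi 0) = 1
  moments : ∀ n : ℕ, Integrable (fun x => x ^ n) ν

/-! ### The mapping `φ` and the mapping `φ'` -/

/-- `(1 - F(x)) L(F(x))`, which is `0` if `F(x)` is `0` or `1`. -/
def weight (μ : Measure ℝ) (x : ℝ) : ℝ := (1 - cdf μ x) * L (cdf μ x)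

/-- The law of `V`, with Lebesgue density `(1 - F(x)) L(F(x)) / ∫ (1 - F(y)) L(F(y)) dy`. -/
def lawV (μ : Measure ℝ) : Measure ℝ :=
  volume.withDensity fun x => ENNReal.ofReal (weight μ x / ∫ y, weight μ y)

/-- `φ` on laws: the law of `T = L(F(V))`. -/
def phi (μ : Measure ℝ) : Measure ℝ := (lawV μ).map fun x => L (cdf μ x)

/-- `(e^y / y) F_T(y-) - ∫_1^y ((x-1)/x²) e^x F_T(x) dx` for `T` with law `ν`. -/
def preH (ν : Measure ℝ) (y : ℝ) : ℝ :=
  Real.exp y / y * ν.real (Iio y) - ∫ x in (1 : ℝ)..y, (x - 1) / x ^ 2 * Real.exp x * cdf ν x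

/-- The constant `c_T`: as `∫_0^∞ e^{-y} dy = 1`, it is the only `c` for which
`∫_0^∞ e^{-y} (preH ν y - c) dy = 0`. -/
def cConst (ν : Measure ℝ) : ℝ := ∫ y in Ioi (0 : ℝ), Real.exp (-y) * preH ν y

/-- The function `H₀` of the inversion formula. -/
def invH (ν : Measure ℝ) (y : ℝ) : ℝ := preH ν y - cConst ν

/-- `φ'` on laws: the law with inverse distribution function `u ↦ H₀(-log (1 - u))`, i.e. the
image of the uniform law on `(0,1)` under this function. -/
def phiInv (ν : Measure ℝ) : Measure ℝ :=
  (volume.restrict (Ioo (0 : ℝ) 1)).map fun u => invH ν (L u)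

end

end RecordSeq

open RecordSeq

/-! Write `F⁻¹ = H ∘ L`. Summing over the possible record times shows that the `(n+1)`-st uniform
record has density `L(u)^n / n!`, so its image under `L` is gamma distributed (`map_L_recordValue`).
Hence `ρ_{n+1} = ∫ y^n e^{-y} / n! · H(y) dy`, which is `recordMean H n`.

Since `H y ≤ x` holds exactly when `F x ≥ 1 - e^{-y}`, the map `L ∘ F` carries Lebesgue measure on
`{0 < F < 1}` to the Stieltjes measure `dH` (`levelMeasure_Ico`), and `T = φ(X)` has density
proportional to `y e^{-y}` with respect to `dH` (`phi_eq_withDensity`). Integrating `y^{n+1} e^{-y}`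
against `dH` by parts gives `E T^n / n! = (n+1) (ρ_{n+2} - ρ_{n+1}) / (ρ_2 - ρ_1)`. Up to the factor
`ρ_2 - ρ_1` these are the Taylor coefficients of the derivative of `(1-t) G_ρ(t)`, which is the
formula for `M_T`.

Each of the four conditions says that `ρ_n` grows at most geometrically (`GeomBdd`). For (ii) this
is the positive radius of convergence, and for (iv) it is read off the moments. For (iii), `ρ_n` and
`w_n` differ by a bounded amount, because `H` is bounded below on `[1, ∞)`. Condition (iii) also
means that `e^{ty} e^{-y} |H(y)|` is integrable for some `t > 0`; Young's inequality derives this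
from (i), and the monotonicity of `H` gives the converse.

For the inversion, `dH = (ρ_2 - ρ_1) (e^y / y) dF_T`, and `preH` is the integral of `e^y / y`
against `dF_T` after an integration by parts. Thus `H₀` is `H` up to an affine map (`invH_phi`).
Uniqueness holds because a moment generating function that is finite near zero extends analytically
to a strip containing the imaginary axis, and so determines the law. -/

namespace RecordSeq

open scoped ENNReal

/-! ### Record times of a sequence. -/

/-- `t` is the time of the `(n+1)`-st upper record of `y`. -/
def IsRecordTime (y : ℕ → ℝ) : ℕ → ℕ → Prop
  | 0, t => t = 0
  | n + 1, t => ∃ s < t, IsRecordTime y n s ∧ y s < y t ∧ ∀ m, s < m → m < t → y m ≤ y s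

/-- The predicate asserts existence, so the value 0 of the infimum of the empty set never
interferes. It also makes record times unique. -/
lemma IsRecordTime.recordTime_eq {y : ℕ → ℝ} {n t : ℕ} (h : IsRecordTime y n t) :
    recordTime y n = t := by
  induction n generalizing t with
  | zero => exact h.symm
  | succ n ih =>
    obtain ⟨s, hst, hs, hlt, hle⟩ := h
    rw [recordTime, ih hs]
    refine le_antisymm (Nat.sInf_le ⟨hst, hlt⟩) ?_
    refine le_csInf ⟨t, hst, hlt⟩ ?_
    rintro m ⟨hm, hm'⟩
    by_contra! hmt
    exact absurd (hle m hm hmt) (not_le.2 hm')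

/-- The stopping time property, which allows later variables to be integrated out independently. -/
lemma isRecordTime_congr {y z : ℕ → ℝ} {n t : ℕ} (h : ∀ i ≤ t, y i = z i) :
    IsRecordTime y n t ↔ IsRecordTime z n t := by
  induction n generalizing t with
  | zero => rfl
  | succ n ih =>
    refine exists_congr fun s => and_congr_right fun hs => ?_
    rw [ih fun i hi => h i (hi.trans hs.le), h s hs.le, h t le_rfl]
    refine and_congr_right fun _ => and_congr_right fun _ => forall_congr' fun m =>
      imp_congr_right fun _ => imp_congr_right fun hm => ?_
    rw [h m hm.le]

lemma measurableSet_isRecordTime (n t : ℕ) : MeasurableSet {y : ℕ → ℝ | IsRecordTime y n t} := by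
  induction n generalizing t with
  | zero => exact MeasurableSet.const _
  | succ n ih =>
    have : {y : ℕ → ℝ | IsRecordTime y (n + 1) t} = ⋃ s ∈ Iio t,
        ({y | IsRecordTime y n s} ∩ {y | y s < y t} ∩
          ⋂ m ∈ Ioo s t, {y : ℕ → ℝ | y m ≤ y s}) := by
      ext y
      simp only [IsRecordTime, mem_ofPred_eq, mem_iUnion, mem_inter_iff, mem_iInter, mem_Iio,
        mem_Ioo, exists_prop, and_assoc, and_imp]
    rw [this]
    refine MeasurableSet.biUnion (to_countable _) fun s _ => ?_
    refine ((ih s).inter (measurableSet_lt (measurable_pi_apply _) (measurable_pi_apply _))).inter ?_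
    exact MeasurableSet.biInter (to_countable _) fun m _ =>
      measurableSet_le (measurable_pi_apply _) (measurable_pi_apply _)

/-! ### The law of the uniform records. -/

section Law

variable {S : Type*} [MeasurableSpace S] {Q : Measure S} [IsProbabilityMeasure Q] {Y : ℕ → S → ℝ}

/-- The uniform law on the unit interval. -/
noncomputable abbrev unifLaw : Measure ℝ := volume.restrict (Ioo (0 : ℝ) 1)

instance : IsProbabilityMeasure unifLaw := ⟨by simp⟩

/-- Independence and Tonelli: a variable independent of the past may be replaced by an integral over
its law. -/
lemma lintegral_trunc_next (hYm : ∀ i, Measurable (Y i)) (hYi : iIndepFun Y Q)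
    (hYl : ∀ i, Q.map (Y i) = unifLaw) (N : ℕ) {Φ : (ℕ → ℝ) → ℝ → ℝ≥0∞}
    (hΦ : Measurable (Function.uncurry Φ))
    (hΦN : ∀ y z u, (∀ i < N, y i = z i) → Φ y u = Φ z u) :
    ∫⁻ s, Φ (fun i => Y i s) (Y N s) ∂Q = ∫⁻ s, ∫⁻ u, Φ (fun i => Y i s) u ∂unifLaw ∂Q := by
  -- Zeroing the coordinates from `N` on leaves `Φ` unchanged and makes the sequence a function of
  -- the variables before `Y N`, hence independent of it.
  set W : S → ℕ → ℝ := fun s i => if i < N then Y i s else 0 with hW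
  have hWY : ∀ s u, Φ (fun i => Y i s) u = Φ (W s) u := fun s u =>
    hΦN _ _ _ fun i hi => by simp [hW, hi]
  simp_rw [hWY]
  have hWm : Measurable W := by
    refine measurable_pi_iff.2 fun i => ?_
    by_cases hi : i < N <;> simp [hW, hi, hYm]
  have hind : IndepFun W (Y N) Q := by
    have h := hYi.indepFun_finset (Finset.range N) {N} (by simp) hYm
    let f : ({x // x ∈ Finset.range N} → ℝ) → ℕ → ℝ := fun v i =>
      if hi : i < N then v ⟨i, Finset.mem_range.2 hi⟩ else 0
    let g : ({x // x ∈ ({N} : Finset ℕ)} → ℝ) → ℝ := fun v => v ⟨N, by simp⟩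
    have hf : Measurable f := by
      refine measurable_pi_iff.2 fun i => ?_
      by_cases hi : i < N
      · simp only [f, hi, dite_true]; exact measurable_pi_apply _
      · simp [f, hi]
    have hg : Measurable g := measurable_pi_apply _
    have := h.comp hf hg
    convert! this using 1
  have hmap := (indepFun_iff_map_prod_eq_prod_map_map hWm.aemeasurable (hYm N).aemeasurable).1 hind
  calc ∫⁻ s, Φ (W s) (Y N s) ∂Q
      = ∫⁻ p, Function.uncurry Φ p ∂(Q.map fun s => (W s, Y N s)) := by
        rw [lintegral_map hΦ (hWm.prodMk (hYm N))]; rfl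
    _ = ∫⁻ y, ∫⁻ u, Φ y u ∂unifLaw ∂(Q.map W) := by
        rw [hmap, hYl, lintegral_prod _ hΦ.aemeasurable]; rfl
    _ = _ := by
        rw [lintegral_map _ hWm]
        exact hΦ.lintegral_prod_right'

/-- The sequences that do not exceed `y s` at the `k` times after `s`. -/
def staysBelow (s k : ℕ) : Set (ℕ → ℝ) := {y | ∀ m, s < m → m < s + 1 + k → y m ≤ y s}

lemma measurableSet_staysBelow (s k : ℕ) : MeasurableSet (staysBelow s k) := by
  simp only [staysBelow, ofPred_forall]
  exact MeasurableSet.iInter fun m => MeasurableSet.iInter fun _ => MeasurableSet.iInter fun _ =>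
    measurableSet_le (measurable_pi_apply _) (measurable_pi_apply _)

lemma mem_staysBelow_congr {s k : ℕ} {y z : ℕ → ℝ} (h : ∀ i < s + 1 + k, y i = z i) :
    y ∈ staysBelow s k ↔ z ∈ staysBelow s k := by
  refine forall_congr' fun m => imp_congr_right fun _ => imp_congr_right fun hm => ?_
  rw [h m hm, h s (by omega)]

lemma mem_staysBelow_succ {s k : ℕ} {y : ℕ → ℝ} :
    y ∈ staysBelow s (k + 1) ↔ y ∈ staysBelow s k ∧ y (s + 1 + k) ≤ y s := by
  constructor
  · exact fun h => ⟨fun m h1 h2 => h m h1 (by omega), h _ (by omega) (by omega)⟩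
  · rintro ⟨h, h'⟩ m h1 h2
    rcases Nat.lt_or_ge m (s + 1 + k) with h3 | h3
    · exact h m h1 h3
    · obtain rfl : m = s + 1 + k := by omega
      exact h'

lemma measurable_unifLaw_Iic : Measurable fun x : ℝ => unifLaw (Iic x) := by
  have : Monotone fun x : ℝ => unifLaw (Iic x) := fun _ _ h => measure_mono (Iic_subset_Iic.2 h)
  exact this.measurable

/-- Integrating out the last of the `k` variables after time `s` yields one factor `F(Y_s)`, with
`F` the uniform distribution function. -/
lemma lintegral_staysBelow (hYm : ∀ i, Measurable (Y i)) (hYi : iIndepFun Y Q)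
    (hYl : ∀ i, Q.map (Y i) = unifLaw) (s k : ℕ) {f : (ℕ → ℝ) → ℝ≥0∞}
    (hf : Measurable f) (hfs : ∀ y z, (∀ i ≤ s, y i = z i) → f y = f z) :
    ∫⁻ a, (staysBelow s k).indicator f (fun i => Y i a) ∂Q
      = ∫⁻ a, f (fun i => Y i a) * unifLaw (Iic (Y s a)) ^ k ∂Q := by
  induction k generalizing f with
  | zero =>
    refine lintegral_congr fun a => ?_
    rw [indicator_of_mem, pow_zero, mul_one]
    intro m h1 h2; omega
  | succ k ih =>
    let Φ : (ℕ → ℝ) → ℝ → ℝ≥0∞ := fun y u =>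
      (staysBelow s k).indicator f y * (Iic (y s)).indicator 1 u
    have hΦ : Measurable (Function.uncurry Φ) := by
      refine ((hf.indicator (measurableSet_staysBelow s k)).comp measurable_fst).mul ?_
      have : MeasurableSet {p : (ℕ → ℝ) × ℝ | p.2 ≤ p.1 s} :=
        measurableSet_le measurable_snd ((measurable_pi_apply s).comp measurable_fst)
      exact (measurable_const (a := (1 : ℝ≥0∞))).indicator this
    have h1 := lintegral_trunc_next hYm hYi hYl (s + 1 + k) hΦ (by
      intro y z u h
      have hs : y s = z s := h s (by omega)
      have hfz : f y = f z := hfs y z fun i hi => h i (by omega)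
      have hmem := mem_staysBelow_congr h
      simp only [Φ, hs]
      congr 1
      by_cases hy : y ∈ staysBelow s k
      · rw [indicator_of_mem hy, indicator_of_mem (hmem.1 hy), hfz]
      · rw [indicator_of_notMem hy, indicator_of_notMem (fun h => hy (hmem.2 h))])
    have h2 : ∀ a, (staysBelow s (k + 1)).indicator f
        (fun i => Y i a) = Φ (fun i => Y i a) (Y (s + 1 + k) a) := by
      intro a
      have hiff := mem_staysBelow_succ (s := s) (k := k) (y := fun i => Y i a)
      simp only [Φ]
      by_cases hy : (fun i => Y i a) ∈ staysBelow s k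
      · by_cases hu : Y (s + 1 + k) a ≤ Y s a
        · rw [indicator_of_mem (hiff.2 ⟨hy, hu⟩), indicator_of_mem hy,
            indicator_of_mem (show Y (s + 1 + k) a ∈ Iic (Y s a) from hu)]
          simp
        · rw [indicator_of_notMem (fun h => hu (hiff.1 h).2),
            indicator_of_notMem (show Y (s + 1 + k) a ∉ Iic (Y s a) from hu), mul_zero]
      · rw [indicator_of_notMem (fun h => hy (hiff.1 h).1), indicator_of_notMem hy, zero_mul]
    simp_rw [h2]
    rw [h1]
    have h3 : ∀ a, ∫⁻ u, Φ (fun i => Y i a) u ∂unifLaw =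
        (staysBelow s k).indicator
          (fun y => f y * unifLaw (Iic (y s))) (fun i => Y i a) := by
      intro a
      simp only [Φ]
      rw [lintegral_const_mul _ (measurable_one.indicator measurableSet_Iic),
        lintegral_indicator_one measurableSet_Iic]
      by_cases hy : (fun i => Y i a) ∈ staysBelow s k
      · rw [indicator_of_mem hy, indicator_of_mem hy]
      · rw [indicator_of_notMem hy, indicator_of_notMem hy, zero_mul]
    simp_rw [h3]
    -- The new factor is absorbed into the test function, which still depends only on the
    -- coordinates up to `s`.
    rw [ih (f := fun y => f y * unifLaw (Iic (y s)))
      (hf.mul (measurable_unifLaw_Iic.comp (measurable_pi_apply s)))]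
    · refine lintegral_congr fun a => ?_
      rw [pow_succ', mul_assoc]
    · intro y z h
      simp only [hfs y z h, h s le_rfl]

/-- Decomposition by the preceding record time `s`. It is unique, so at most one summand is nonzero.
-/
lemma indicator_isRecordTime_succ (n t : ℕ) (g : ℝ → ℝ≥0∞) (y : ℕ → ℝ) :
    {y | IsRecordTime y (n + 1) t}.indicator (fun y => g (y t)) y =
      ∑' s, {y | s < t ∧ IsRecordTime y n s ∧ y s < y t ∧ ∀ m, s < m → m < t → y m ≤ y s}.indicator
        (fun y => g (y t)) y := by
  by_cases h : IsRecordTime y (n + 1) t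
  · obtain ⟨s, hs⟩ := id h
    rw [indicator_of_mem (show y ∈ {y | IsRecordTime y (n + 1) t} from h), tsum_eq_single s,
      indicator_of_mem (by exact hs)]
    intro s' hs'
    refine indicator_of_notMem (fun h' => hs' ?_) _
    rw [← hs.2.1.recordTime_eq, ← h'.2.1.recordTime_eq]
  · rw [indicator_of_notMem (by exact h), eq_comm, ENNReal.tsum_eq_zero]
    intro s
    rw [indicator_of_notMem]
    exact fun h' => h ⟨s, h'⟩

/-- One step of the record chain: from the value `x` the next record is uniform on `(x, 1)`. The
normalization `1 / (1 - F(x))` is the geometric series over the number of failures before the next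
record. -/
lemma tsum_lintegral_isRecordTime_succ (hYm : ∀ i, Measurable (Y i)) (hYi : iIndepFun Y Q)
    (hYl : ∀ i, Q.map (Y i) = unifLaw) (n : ℕ) {g : ℝ → ℝ≥0∞} (hg : Measurable g) :
    ∑' t, ∫⁻ a, {y | IsRecordTime y (n + 1) t}.indicator (fun y => g (y t)) (fun i => Y i a) ∂Q =
      ∑' s, ∫⁻ a, {y | IsRecordTime y n s}.indicator
        (fun y => (∫⁻ u in Ioi (y s), g u ∂unifLaw) * (1 - unifLaw (Iic (y s)))⁻¹)
          (fun i => Y i a) ∂Q := by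
  have hYpi : Measurable fun a => fun i => Y i a := measurable_pi_iff.2 hYm
  have hK : Measurable fun x : ℝ => ∫⁻ u in Ioi x, g u ∂unifLaw := by
    have : Antitone fun x : ℝ => ∫⁻ u in Ioi x, g u ∂unifLaw :=
      fun _ _ h => lintegral_mono_set (Ioi_subset_Ioi h)
    exact this.measurable
  have hmeas : ∀ s t, MeasurableSet
      {y : ℕ → ℝ | s < t ∧ IsRecordTime y n s ∧ y s < y t ∧ ∀ m, s < m → m < t → y m ≤ y s} := by
    intro s t
    have : {y : ℕ → ℝ | s < t ∧ IsRecordTime y n s ∧ y s < y t ∧ ∀ m, s < m → m < t → y m ≤ y s}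
        = {y | s < t} ∩ {y | IsRecordTime y n s} ∩ {y | y s < y t} ∩
          ⋂ m ∈ Ioo s t, {y : ℕ → ℝ | y m ≤ y s} := by
      ext y
      simp only [mem_ofPred_eq, mem_inter_iff, mem_iInter, mem_Ioo, and_assoc, and_imp]
    rw [this]
    refine (((MeasurableSet.const _).inter (measurableSet_isRecordTime n s)).inter
      (measurableSet_lt (measurable_pi_apply _) (measurable_pi_apply _))).inter ?_
    exact MeasurableSet.biInter (to_countable _) fun m _ =>
      measurableSet_le (measurable_pi_apply _) (measurable_pi_apply _)
  have hgt : ∀ t, Measurable fun y : ℕ → ℝ => g (y t) := fun t => hg.comp (measurable_pi_apply t)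
  simp_rw [indicator_isRecordTime_succ]
  have h1 : ∀ t, ∫⁻ a, ∑' s, {y : ℕ → ℝ | s < t ∧ IsRecordTime y n s ∧ y s < y t ∧
      ∀ m, s < m → m < t → y m ≤ y s}.indicator (fun y => g (y t)) (fun i => Y i a) ∂Q =
      ∑' s, ∫⁻ a, {y : ℕ → ℝ | s < t ∧ IsRecordTime y n s ∧ y s < y t ∧
      ∀ m, s < m → m < t → y m ≤ y s}.indicator (fun y => g (y t)) (fun i => Y i a) ∂Q :=
    fun t => lintegral_tsum fun s => (((hgt t).indicator (hmeas s t)).comp hYpi).aemeasurable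
  simp_rw [h1]
  rw [ENNReal.tsum_comm]
  refine tsum_congr fun s => ?_
  -- The next record comes at `s + 1 + k`, with `k` variables in between. Terms with `t ≤ s` vanish.
  have hinj : Function.Injective fun k : ℕ => s + 1 + k := fun a b h => by simpa using h
  rw [← hinj.tsum_eq (f := fun t => ∫⁻ a, {y : ℕ → ℝ | s < t ∧ IsRecordTime y n s ∧ y s < y t ∧
      ∀ m, s < m → m < t → y m ≤ y s}.indicator (fun y => g (y t)) (fun i => Y i a) ∂Q)]
  swap
  · intro t ht
    by_contra hrange
    refine ht ?_
    have hst : ¬ s < t := fun h => hrange ⟨t - (s + 1), by simp only; omega⟩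
    simp [hst]
  set f : (ℕ → ℝ) → ℝ≥0∞ := {y | IsRecordTime y n s}.indicator
    fun y => ∫⁻ u in Ioi (y s), g u ∂unifLaw with hfdef
  have hf : Measurable f :=
    (hK.comp (measurable_pi_apply s)).indicator (measurableSet_isRecordTime n s)
  have hind : ∀ (ψ : ℝ → ℝ≥0∞) (y z : ℕ → ℝ), (∀ i ≤ s, y i = z i) →
      {y | IsRecordTime y n s}.indicator (fun y => ψ (y s)) y =
      {y | IsRecordTime y n s}.indicator (fun y => ψ (y s)) z := by
    intro ψ y z h
    have hiff := isRecordTime_congr (n := n) h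
    by_cases hy : IsRecordTime y n s
    · rw [indicator_of_mem (by exact hy), indicator_of_mem (by exact hiff.1 hy), h s le_rfl]
    · rw [indicator_of_notMem (by exact hy), indicator_of_notMem (by exact fun h' => hy (hiff.2 h'))]
  have hk : ∀ k, ∫⁻ a, {y : ℕ → ℝ | s < s + 1 + k ∧ IsRecordTime y n s ∧ y s < y (s + 1 + k) ∧
      ∀ m, s < m → m < s + 1 + k → y m ≤ y s}.indicator (fun y => g (y (s + 1 + k)))
        (fun i => Y i a) ∂Q = ∫⁻ a, f (fun i => Y i a) * unifLaw (Iic (Y s a)) ^ k ∂Q := by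
    intro k
    rw [← lintegral_staysBelow hYm hYi hYl s k hf
      (hind fun x => ∫⁻ u in Ioi x, g u ∂unifLaw)]
    let Φ : (ℕ → ℝ) → ℝ → ℝ≥0∞ := fun y u =>
      ({y | IsRecordTime y n s} ∩ staysBelow s k).indicator 1 y * (Ioi (y s)).indicator g u
    have hΦ : Measurable (Function.uncurry Φ) := by
      refine ((measurable_one.indicator ((measurableSet_isRecordTime n s).inter
        (measurableSet_staysBelow s k))).comp measurable_fst).mul ?_
      have : MeasurableSet {p : (ℕ → ℝ) × ℝ | p.1 s < p.2} :=
        measurableSet_lt ((measurable_pi_apply s).comp measurable_fst) measurable_snd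
      exact (hg.comp measurable_snd).indicator this
    have h1 := lintegral_trunc_next hYm hYi hYl (s + 1 + k) hΦ (by
      intro y z u h
      have hs : y s = z s := h s (by omega)
      have hmem : y ∈ {y | IsRecordTime y n s} ∩ staysBelow s k ↔
          z ∈ {y | IsRecordTime y n s} ∩ staysBelow s k :=
        and_congr (isRecordTime_congr fun i hi => h i (by omega)) (mem_staysBelow_congr h)
      simp only [Φ, hs]
      congr 1
      by_cases hy : y ∈ {y | IsRecordTime y n s} ∩ staysBelow s k
      · rw [indicator_of_mem hy, indicator_of_mem (hmem.1 hy)]; rfl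
      · rw [indicator_of_notMem hy, indicator_of_notMem (fun h => hy (hmem.2 h))])
    trans ∫⁻ a, Φ (fun i => Y i a) (Y (s + 1 + k) a) ∂Q
    · refine lintegral_congr fun a => ?_
      simp only [Φ]
      by_cases hy : (fun i => Y i a) ∈ {y | IsRecordTime y n s} ∩ staysBelow s k
      · rw [indicator_of_mem hy, Pi.one_apply, one_mul]
        by_cases hu : Y s a < Y (s + 1 + k) a
        · rw [indicator_of_mem (show Y (s + 1 + k) a ∈ Ioi (Y s a) from hu), indicator_of_mem]
          exact ⟨by omega, hy.1, hu, hy.2⟩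
        · rw [indicator_of_notMem (show Y (s + 1 + k) a ∉ Ioi (Y s a) from hu),
            indicator_of_notMem fun h => hu h.2.2.1]
      · rw [indicator_of_notMem hy, zero_mul, indicator_of_notMem]
        exact fun h => hy ⟨h.2.1, h.2.2.2⟩
    · rw [h1]
      refine lintegral_congr fun a => ?_
      simp only [Φ]
      rw [lintegral_const_mul _ (hg.indicator measurableSet_Ioi),
        lintegral_indicator measurableSet_Ioi, hfdef, indicator_indicator, inter_comm]
      by_cases hy : (fun i => Y i a) ∈ staysBelow s k ∩ {y | IsRecordTime y n s}
      · rw [indicator_of_mem hy, indicator_of_mem hy, Pi.one_apply, one_mul]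
      · rw [indicator_of_notMem hy, indicator_of_notMem hy, zero_mul]
  simp_rw [hk]
  rw [← lintegral_tsum (f := fun k a => f (fun i => Y i a) * unifLaw (Iic (Y s a)) ^ k)
    fun k => ((hf.comp hYpi).mul
    ((measurable_unifLaw_Iic.comp (hYm s)).pow_const k)).aemeasurable]
  refine lintegral_congr fun a => ?_
  -- In `[0, ∞]` the geometric series needs no bound on its ratio.
  rw [ENNReal.tsum_mul_left, ENNReal.tsum_geometric, hfdef]
  by_cases hy : (fun i => Y i a) ∈ {y | IsRecordTime y n s}
  · rw [indicator_of_mem hy, indicator_of_mem hy]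
  · rw [indicator_of_notMem hy, indicator_of_notMem hy, zero_mul]

lemma L_nonneg {u : ℝ} (h0 : 0 ≤ u) (h1 : u ≤ 1) : 0 ≤ L u :=
  neg_nonneg.2 (Real.log_nonpos (by linarith) (by linarith))

lemma measurable_L : Measurable L := (Real.measurable_log.comp (measurable_const.sub measurable_id)).neg

lemma hasDerivAt_L {u : ℝ} (h : u < 1) : HasDerivAt L (1 - u)⁻¹ u := by
  have := (((hasDerivAt_id u).const_sub 1).log (by simpa using sub_ne_zero.2 h.ne')).neg
  refine this.congr_deriv ?_
  simp [id, neg_div]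

/-- Since `L' = 1 / (1 - u)`, the integrand is the derivative of `L^(n+1) / (n+1)!`. -/
lemma lintegral_L_pow_div (n : ℕ) {u : ℝ} (h0 : 0 < u) (h1 : u < 1) :
    ∫⁻ x in Ioo 0 u, ENNReal.ofReal (L x ^ n / n.factorial) * (ENNReal.ofReal (1 - x))⁻¹ =
      ENNReal.ofReal (L u ^ (n + 1) / (n + 1).factorial) := by
  have hd : ∀ x ∈ Icc (0 : ℝ) u, HasDerivAt (fun x => L x ^ (n + 1) / (n + 1).factorial)
      (L x ^ n / n.factorial * (1 - x)⁻¹) x := by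
    intro x hx
    have := ((hasDerivAt_L (hx.2.trans_lt h1)).pow (n + 1)).div_const ((n + 1).factorial : ℝ)
    refine this.congr_deriv ?_
    have h2 : (n.factorial : ℝ) ≠ 0 := by positivity
    rw [Nat.factorial_succ]
    push_cast
    field_simp
  have hcont : ContinuousOn (fun x => L x ^ n / n.factorial * (1 - x)⁻¹) (Icc 0 u) := by
    intro x hx
    have h3 : x < 1 := hx.2.trans_lt h1
    refine ContinuousAt.continuousWithinAt ?_
    refine (((hasDerivAt_L h3).continuousAt.pow n).div_const _).mul ?_
    exact (continuousAt_const.sub continuousAt_id).inv₀ (sub_ne_zero.2 h3.ne')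
  have hint : IntegrableOn (fun x => L x ^ n / n.factorial * (1 - x)⁻¹) (Ioo 0 u) :=
    (hcont.integrableOn_Icc).mono_set Ioo_subset_Icc_self
  have hftc := intervalIntegral.integral_eq_sub_of_hasDerivAt (a := 0) (b := u)
    (f := fun x => L x ^ (n + 1) / (n + 1).factorial)
    (fun x hx => hd x (by rwa [uIcc_of_le h0.le] at hx))
    ((intervalIntegrable_iff_integrableOn_Ioo_of_le h0.le).2 hint)
  have hL0 : L 0 = 0 := by simp [L]
  rw [hL0, zero_pow (by omega), zero_div, sub_zero, intervalIntegral.integral_of_le h0.le,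
    integral_Ioc_eq_integral_Ioo] at hftc
  rw [← hftc, ofReal_integral_eq_lintegral_ofReal hint]
  · refine setLIntegral_congr_fun measurableSet_Ioo fun x hx => ?_
    have h3 : 0 < 1 - x := by linarith [hx.2]
    have h4 := L_nonneg hx.1.le (hx.2.trans h1).le
    rw [ENNReal.ofReal_mul (by positivity), ENNReal.ofReal_inv_of_pos h3]
  · refine (ae_restrict_mem measurableSet_Ioo).mono fun x hx => ?_
    have h3 : 0 < 1 - x := by linarith [hx.2]
    have h4 := L_nonneg hx.1.le (hx.2.trans h1).le
    have h5 := inv_nonneg.2 h3.le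
    exact mul_nonneg (by positivity) h5

lemma unifLaw_Iic {x : ℝ} (h1 : x < 1) : unifLaw (Iic x) = ENNReal.ofReal x := by
  rw [Measure.restrict_apply measurableSet_Iic]
  have : Iic x ∩ Ioo 0 1 = Ioc 0 x := by
    ext z
    simp only [mem_inter_iff, mem_Iic, mem_Ioo, mem_Ioc]
    exact ⟨fun h => ⟨h.2.1, h.1⟩, fun h => ⟨h.2, h.1, h.2.trans_lt h1⟩⟩
  rw [this, Real.volume_Ioc, sub_zero]

/-- Induction along the record chain. After Tonelli, the integral over the previous record `x < u`
raises the power of `L` by one, by `lintegral_L_pow_div`. Almost sure existence of records is not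
assumed here but deduced from it later. -/
lemma tsum_lintegral_isRecordTime (hYm : ∀ i, Measurable (Y i)) (hYi : iIndepFun Y Q)
    (hYl : ∀ i, Q.map (Y i) = unifLaw) (n : ℕ) {g : ℝ → ℝ≥0∞} (hg : Measurable g) :
    ∑' t, ∫⁻ a, {y | IsRecordTime y n t}.indicator (fun y => g (y t)) (fun i => Y i a) ∂Q =
      ∫⁻ u, ENNReal.ofReal (L u ^ n / n.factorial) * g u ∂unifLaw := by
  induction n generalizing g with
  | zero =>
    rw [tsum_eq_single 0]
    · rw [← hYl 0, lintegral_map (f := fun u => ENNReal.ofReal (L u ^ 0 / (Nat.factorial 0)) * g u)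
        (((measurable_L.pow_const _).div_const _).ennreal_ofReal.mul hg) (hYm 0)]
      refine lintegral_congr fun a => ?_
      rw [indicator_of_mem (by exact rfl)]
      simp
    · intro t ht
      have : ∀ a, {y | IsRecordTime y 0 t}.indicator (fun y => g (y t)) (fun i => Y i a) = 0 := by
        intro a
        rw [indicator_of_notMem]
        exact fun h => ht h
      simp [this]
  | succ n ih =>
    have hK : Measurable fun x : ℝ => ∫⁻ u in Ioi x, g u ∂unifLaw := by
      have : Antitone fun x : ℝ => ∫⁻ u in Ioi x, g u ∂unifLaw :=
        fun _ _ h => lintegral_mono_set (Ioi_subset_Ioi h)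
      exact this.measurable
    -- The induction hypothesis is applied to the mean of `g` at the next record as a function of
    -- the current one.
    rw [tsum_lintegral_isRecordTime_succ hYm hYi hYl n hg,
      ih (g := fun x => (∫⁻ u in Ioi x, g u ∂unifLaw) * (1 - unifLaw (Iic x))⁻¹)
        (hK.mul (measurable_const.sub measurable_unifLaw_Iic).inv)]
    have hLm := measurable_L
    have h1 : ∀ x ∈ Ioo (0 : ℝ) 1, ENNReal.ofReal (L x ^ n / n.factorial) *
        ((∫⁻ u in Ioi x, g u ∂unifLaw) * (1 - unifLaw (Iic x))⁻¹) =
        ∫⁻ u, ENNReal.ofReal (L x ^ n / n.factorial) * (ENNReal.ofReal (1 - x))⁻¹ *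
          {p : ℝ × ℝ | p.1 < p.2}.indicator (fun p => g p.2) (x, u) ∂unifLaw := by
      intro x hx
      have hm : Measurable fun u => {p : ℝ × ℝ | p.1 < p.2}.indicator (fun p => g p.2) (x, u) :=
        ((hg.comp measurable_snd).indicator (measurableSet_lt measurable_fst measurable_snd)).comp
          (measurable_const.prodMk measurable_id)
      rw [lintegral_const_mul _ hm, unifLaw_Iic hx.2, ← lintegral_indicator measurableSet_Ioi,
        ENNReal.ofReal_sub _ hx.1.le, ENNReal.ofReal_one, mul_assoc]
      congr 1
      rw [mul_comm]
      rfl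
    rw [setLIntegral_congr_fun measurableSet_Ioo h1, lintegral_lintegral_swap]
    · refine setLIntegral_congr_fun measurableSet_Ioo fun u hu => ?_
      have h2 : ∀ x, ENNReal.ofReal (L x ^ n / n.factorial) * (ENNReal.ofReal (1 - x))⁻¹ *
          {p : ℝ × ℝ | p.1 < p.2}.indicator (fun p => g p.2) (x, u) =
          (Iio u).indicator (fun x => ENNReal.ofReal (L x ^ n / n.factorial) *
            (ENNReal.ofReal (1 - x))⁻¹) x * g u := by
        intro x
        by_cases hx : x < u
        · rw [indicator_of_mem (by exact hx), indicator_of_mem (by exact hx)]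
        · rw [indicator_of_notMem (by exact hx), indicator_of_notMem (by exact hx), mul_zero,
            zero_mul]
      simp_rw [h2]
      have h3 : Measurable fun x => ENNReal.ofReal (L x ^ n / n.factorial) *
            (ENNReal.ofReal (1 - x))⁻¹ := by fun_prop
      rw [lintegral_mul_const _ (h3.indicator measurableSet_Iio),
        lintegral_indicator measurableSet_Iio, Measure.restrict_restrict measurableSet_Iio,
        ← lintegral_L_pow_div n hu.1 hu.2, show Iio u ∩ Ioo 0 1 = Ioo 0 u from ?_]
      ext z
      simp only [mem_inter_iff, mem_Iio, mem_Ioo]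
      exact ⟨fun h => ⟨h.2.1, h.1⟩, fun h => ⟨h.2, h.1, h.2.trans hu.2⟩⟩
    · refine Measurable.aemeasurable ?_
      refine Measurable.mul ?_ ?_
      · exact (by fun_prop : Measurable fun x => ENNReal.ofReal (L x ^ n / n.factorial) *
            (ENNReal.ofReal (1 - x))⁻¹).comp measurable_fst
      · exact (hg.comp measurable_snd).indicator (measurableSet_lt measurable_fst measurable_snd)

lemma tsum_indicator_isRecordTime (n : ℕ) (g : ℝ → ℝ≥0∞) {y : ℕ → ℝ}
    (h : ∃ t, IsRecordTime y n t) :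
    ∑' t, {y | IsRecordTime y n t}.indicator (fun y => g (y t)) y = g (recordValue y n) := by
  obtain ⟨t, ht⟩ := h
  rw [tsum_eq_single t, indicator_of_mem (by exact ht), recordValue, ht.recordTime_eq]
  intro s hs
  rw [indicator_of_notMem]
  exact fun h => hs (h.recordTime_eq.symm.trans ht.recordTime_eq)

/-! ### The exponential substitution and gamma laws. -/

lemma L_one_sub_exp_neg (y : ℝ) : L (1 - Real.exp (-y)) = y := by simp [L]

/-- The substitution `u = 1 - e^{-y}`, by the change of variables formula for injective maps, which
asks for no measurability of `f`. -/
lemma lintegral_unifLaw_comp_L (f : ℝ → ℝ≥0∞) :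
    ∫⁻ u, f (L u) ∂unifLaw = ∫⁻ y in Ioi (0 : ℝ), ENNReal.ofReal (Real.exp (-y)) * f y := by
  have himage : (fun y : ℝ => 1 - Real.exp (-y)) '' Ioi 0 = Ioo 0 1 := by
    ext u
    constructor
    · rintro ⟨y, hy, rfl⟩
      have hy' : 0 < y := hy
      exact ⟨by simpa using hy', by simpa using Real.exp_pos (-y)⟩
    · rintro ⟨h0, h1⟩
      refine ⟨L u, ?_, ?_⟩
      · exact neg_pos.2 (Real.log_neg (by linarith) (by linarith))
      · simp [L, Real.exp_log (show 0 < 1 - u by linarith)]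
  have hd : ∀ y ∈ Ioi (0 : ℝ), HasDerivWithinAt (fun y : ℝ => 1 - Real.exp (-y)) (Real.exp (-y))
      (Ioi 0) y := by
    intro y _
    have := ((hasDerivAt_neg y).exp.const_sub 1).hasDerivWithinAt (s := Ioi 0)
    simpa using this
  rw [unifLaw, ← himage, lintegral_image_eq_lintegral_abs_deriv_mul measurableSet_Ioi hd]
  · simp [L_one_sub_exp_neg]
  · intro a _ b _ h
    simpa using h

/-- The gamma law with parameters `n + 1` and `1`. -/
noncomputable def gammaLaw (n : ℕ) : Measure ℝ :=
  (volume.restrict (Ioi 0)).withDensity fun y =>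
    ENNReal.ofReal (y ^ n * Real.exp (-y) / n.factorial)

lemma integrableOn_pow_mul_exp_neg (n : ℕ) :
    IntegrableOn (fun y : ℝ => y ^ n * Real.exp (-y)) (Ioi 0) := by
  have := Real.GammaIntegral_convergent (s := n + 1) (by positivity)
  refine this.congr_fun (fun y _ => ?_) measurableSet_Ioi
  simp [mul_comm]

lemma integral_pow_mul_exp_neg (n : ℕ) :
    ∫ y in Ioi (0 : ℝ), y ^ n * Real.exp (-y) = n.factorial := by
  rw [← Real.Gamma_nat_eq_factorial, Real.Gamma_eq_integral (by positivity)]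
  refine setIntegral_congr_fun measurableSet_Ioi fun y _ => ?_
  simp [mul_comm]

instance (n : ℕ) : IsProbabilityMeasure (gammaLaw n) := by
  constructor
  rw [gammaLaw, withDensity_apply _ MeasurableSet.univ, Measure.restrict_univ,
    ← ofReal_integral_eq_lintegral_ofReal ((integrableOn_pow_mul_exp_neg n).div_const _),
    integral_div, integral_pow_mul_exp_neg, div_self (by positivity), ENNReal.ofReal_one]
  filter_upwards [ae_restrict_mem measurableSet_Ioi] with y hy
  have : (0 : ℝ) < y := hy
  simp only [Pi.zero_apply]
  positivity

lemma lintegral_gammaLaw (n : ℕ) (f : ℝ → ℝ≥0∞) (hf : Measurable f) :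
    ∫⁻ u, ENNReal.ofReal (L u ^ n / n.factorial) * f (L u) ∂unifLaw = ∫⁻ y, f y ∂gammaLaw n := by
  rw [gammaLaw, lintegral_withDensity_eq_lintegral_mul _ (by fun_prop) hf,
    lintegral_unifLaw_comp_L fun y => ENNReal.ofReal (y ^ n / n.factorial) * f y]
  refine setLIntegral_congr_fun measurableSet_Ioi fun y hy => ?_
  have hy' : (0 : ℝ) < y := hy
  simp only [Pi.mul_apply]
  rw [← mul_assoc, ← ENNReal.ofReal_mul (by positivity)]
  congr 2
  ring

omit [IsProbabilityMeasure Q] in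
lemma lintegral_tsum_isRecordTime (hYm : ∀ i, Measurable (Y i)) (n : ℕ)
    {g : ℝ → ℝ≥0∞} (hg : Measurable g) :
    ∑' t, ∫⁻ a, {y | IsRecordTime y n t}.indicator (fun y => g (y t)) (fun i => Y i a) ∂Q =
      ∫⁻ a, ∑' t, {y | IsRecordTime y n t}.indicator (fun y => g (y t)) (fun i => Y i a) ∂Q :=
  (lintegral_tsum fun t => (((hg.comp (measurable_pi_apply t)).indicator
      (measurableSet_isRecordTime n t)).comp (measurable_pi_iff.2 hYm)).aemeasurable).symm

/-- For the test function 1, `tsum_lintegral_isRecordTime` equates the probability that the record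
exists with the total mass of a gamma law. -/
lemma ae_exists_isRecordTime (hYm : ∀ i, Measurable (Y i)) (hYi : iIndepFun Y Q)
    (hYl : ∀ i, Q.map (Y i) = unifLaw) (n : ℕ) :
    ∀ᵐ a ∂Q, ∃ t, IsRecordTime (fun i => Y i a) n t := by
  have hYpi : Measurable fun a => fun i => Y i a := measurable_pi_iff.2 hYm
  have hset : MeasurableSet {y : ℕ → ℝ | ∃ t, IsRecordTime y n t} := by
    rw [ofPred_exists]
    exact MeasurableSet.iUnion fun t => measurableSet_isRecordTime n t
  have h1 := tsum_lintegral_isRecordTime hYm hYi hYl n (g := fun _ => 1) measurable_const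
  rw [lintegral_gammaLaw n (fun _ => 1) measurable_const, lintegral_one, measure_univ,
    lintegral_tsum_isRecordTime hYm n measurable_const] at h1
  have h2 : ∀ a, ∑' t, {y | IsRecordTime y n t}.indicator (fun _ => (1 : ℝ≥0∞)) (fun i => Y i a) =
      ((fun a => fun i => Y i a) ⁻¹' {y : ℕ → ℝ | ∃ t, IsRecordTime y n t}).indicator 1 a := by
    intro a
    by_cases ha : ∃ t, IsRecordTime (fun i => Y i a) n t
    · rw [indicator_of_mem (by exact ha), tsum_indicator_isRecordTime n (fun _ => 1) ha]
      rfl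
    · rw [indicator_of_notMem (by exact ha), ENNReal.tsum_eq_zero]
      intro t
      rw [indicator_of_notMem]
      exact fun h => ha ⟨t, h⟩
  simp_rw [h2] at h1
  rw [lintegral_indicator_one (hYpi hset)] at h1
  exact (prob_compl_eq_zero_iff (hYpi hset)).2 h1

lemma lintegral_recordValue (hYm : ∀ i, Measurable (Y i)) (hYi : iIndepFun Y Q)
    (hYl : ∀ i, Q.map (Y i) = unifLaw) (n : ℕ) {g : ℝ → ℝ≥0∞} (hg : Measurable g) :
    ∫⁻ a, g (recordValue (fun i => Y i a) n) ∂Q =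
      ∫⁻ u, ENNReal.ofReal (L u ^ n / n.factorial) * g u ∂unifLaw := by
  rw [← tsum_lintegral_isRecordTime hYm hYi hYl n hg, lintegral_tsum_isRecordTime hYm n hg]
  refine lintegral_congr_ae ?_
  filter_upwards [ae_exists_isRecordTime hYm hYi hYl n] with a ha
  exact (tsum_indicator_isRecordTime n g ha).symm

/-- On the event that the record occurs at time `t` its value is `Y t`, and countably many such
events cover almost everything. -/
lemma aemeasurable_recordValue (hYm : ∀ i, Measurable (Y i)) (hYi : iIndepFun Y Q)
    (hYl : ∀ i, Q.map (Y i) = unifLaw) (n : ℕ) :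
    AEMeasurable (fun a => recordValue (fun i => Y i a) n) Q := by
  have hYpi : Measurable fun a => fun i => Y i a := measurable_pi_iff.2 hYm
  have hae : ∀ᵐ a ∂Q, a ∈ ⋃ t, {a | IsRecordTime (fun i => Y i a) n t} := by
    filter_upwards [ae_exists_isRecordTime hYm hYi hYl n] with a ha using mem_iUnion.2 ha
  have hm : ∀ t, MeasurableSet {a | IsRecordTime (fun i => Y i a) n t} :=
    fun t => hYpi (measurableSet_isRecordTime n t)
  rw [← Measure.restrict_eq_self_of_ae_mem hae, aemeasurable_iUnion_iff]
  intro t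
  refine ⟨Y t, hYm t, ?_⟩
  filter_upwards [ae_restrict_mem (hm t)] with a ha
  rw [recordValue, IsRecordTime.recordTime_eq ha]

/-- The law of the `(n+1)`-st uniform record. -/
theorem map_recordValue (hYm : ∀ i, Measurable (Y i)) (hYi : iIndepFun Y Q)
    (hYl : ∀ i, Q.map (Y i) = unifLaw) (n : ℕ) :
    Q.map (fun a => recordValue (fun i => Y i a) n) =
      unifLaw.withDensity fun u => ENNReal.ofReal (L u ^ n / n.factorial) := by
  ext B hB
  have h := lintegral_recordValue hYm hYi hYl n (measurable_one.indicator hB)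
  rw [withDensity_apply _ hB, Measure.map_apply_of_aemeasurable
    (aemeasurable_recordValue hYm hYi hYl n) hB, ← lintegral_indicator hB]
  rw [← lintegral_map' (f := B.indicator (1 : ℝ → ℝ≥0∞)) (measurable_one.indicator hB).aemeasurable
    (aemeasurable_recordValue hYm hYi hYl n), lintegral_indicator_one hB,
    Measure.map_apply_of_aemeasurable (aemeasurable_recordValue hYm hYi hYl n) hB] at h
  rw [h]
  refine lintegral_congr fun u => ?_
  by_cases hu : u ∈ B
  · rw [indicator_of_mem hu, indicator_of_mem hu, Pi.one_apply, mul_one]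
  · rw [indicator_of_notMem hu, indicator_of_notMem hu, mul_zero]

theorem map_L_recordValue (hYm : ∀ i, Measurable (Y i)) (hYi : iIndepFun Y Q)
    (hYl : ∀ i, Q.map (Y i) = unifLaw) (n : ℕ) :
    Q.map (fun a => L (recordValue (fun i => Y i a) n)) = gammaLaw n := by
  have h1 : Q.map (fun a => L (recordValue (fun i => Y i a) n)) =
      (Q.map fun a => recordValue (fun i => Y i a) n).map L :=
    (AEMeasurable.map_map_of_aemeasurable measurable_L.aemeasurable
      (aemeasurable_recordValue hYm hYi hYl n)).symm
  rw [h1, map_recordValue hYm hYi hYl]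
  ext B hB
  rw [Measure.map_apply measurable_L hB, withDensity_apply _ (measurable_L hB),
    ← lintegral_indicator_one hB, ← lintegral_gammaLaw n _ (measurable_one.indicator hB),
    ← lintegral_indicator (measurable_L hB)]
  refine lintegral_congr fun u => ?_
  by_cases hu : L u ∈ B
  · rw [indicator_of_mem hu, indicator_of_mem (by exact hu), Pi.one_apply, mul_one]
  · rw [indicator_of_notMem hu, indicator_of_notMem (by exact hu), mul_zero]

lemma ae_recordValue_mem (hYm : ∀ i, Measurable (Y i)) (hYi : iIndepFun Y Q)
    (hYl : ∀ i, Q.map (Y i) = unifLaw) (n : ℕ) :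
    ∀ᵐ a ∂Q, recordValue (fun i => Y i a) n ∈ Ioo (0 : ℝ) 1 := by
  refine ae_of_ae_map (aemeasurable_recordValue hYm hYi hYl n) (p := fun u => u ∈ Ioo (0 : ℝ) 1) ?_
  rw [map_recordValue hYm hYi hYl]
  exact (withDensity_absolutelyContinuous _ _).ae_le (ae_restrict_mem measurableSet_Ioo)

end Law

/-! ### The quantile transformation. -/

section Quantile

variable {μ : Measure ℝ} [IsProbabilityMeasure μ] {H : ℝ → ℝ}

-- The Galois connection between a distribution function and its inverse. Right continuity ensures
-- that the infimum is attained.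
omit [IsProbabilityMeasure μ] in
lemma invCdf_le_iff {u : ℝ} (hu : u ∈ Ioo (0 : ℝ) 1) (x : ℝ) :
    invCdf μ u ≤ x ↔ u ≤ cdf μ x := by
  have hne : {x : ℝ | u ≤ cdf μ x}.Nonempty :=
    (((tendsto_cdf_atTop μ).eventually_const_le hu.2).exists)
  have hbdd : BddBelow {x : ℝ | u ≤ cdf μ x} := by
    obtain ⟨b, hb⟩ := ((tendsto_cdf_atBot μ).eventually_lt_const hu.1).exists
    refine ⟨b, fun x hx => ?_⟩
    by_contra! hxb
    exact absurd (hx.trans (monotone_cdf μ hxb.le)) (not_le.2 hb)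
  refine ⟨fun h => ?_, fun h => csInf_le hbdd h⟩
  have hright : Tendsto (cdf μ) (𝓝[>] x) (𝓝 (cdf μ x)) :=
    ((cdf μ).right_continuous x).tendsto.mono_left (nhdsWithin_mono _ Ioi_subset_Ici_self)
  refine ge_of_tendsto hright ?_
  filter_upwards [self_mem_nhdsWithin] with z hz
  obtain ⟨w, hw, hwz⟩ := (csInf_lt_iff hbdd hne).1 (h.trans_lt hz)
  exact hw.trans (monotone_cdf μ hwz.le)

lemma one_sub_exp_neg_mem {y : ℝ} (hy : 0 < y) : 1 - Real.exp (-y) ∈ Ioo (0 : ℝ) 1 :=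
  ⟨by simpa using hy, by simpa using Real.exp_pos (-y)⟩

lemma L_pos {u : ℝ} (hu : u ∈ Ioo (0 : ℝ) 1) : 0 < L u :=
  neg_pos.2 (Real.log_neg (by linarith [hu.2]) (by linarith [hu.1]))

lemma unifLaw_map_L : unifLaw.map L = gammaLaw 0 := by
  ext B hB
  rw [Measure.map_apply measurable_L hB, ← lintegral_indicator_one hB,
    ← lintegral_gammaLaw 0 _ (measurable_one.indicator hB),
    ← lintegral_indicator_one (measurable_L hB)]
  simp only [pow_zero, Nat.factorial_zero, Nat.cast_one, div_one, ENNReal.ofReal_one, one_mul]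
  rfl

lemma MemHStar.aemeasurable_restrict (hH : MemHStar H) :
    AEMeasurable H (volume.restrict (Ioi 0)) :=
  aemeasurable_restrict_of_monotoneOn measurableSet_Ioi hH.mono

lemma MemHStar.aemeasurable_gammaLaw (hH : MemHStar H) (n : ℕ) : AEMeasurable H (gammaLaw n) :=
  hH.aemeasurable_restrict.mono_ac (withDensity_absolutelyContinuous _ _)

omit [IsProbabilityMeasure μ] in
lemma le_iff_of_invCdf (hinv : ∀ u ∈ Ioo (0 : ℝ) 1, invCdf μ u = H (L u)) {y : ℝ} (hy : 0 < y)
    (x : ℝ) : H y ≤ x ↔ 1 - Real.exp (-y) ≤ cdf μ x := by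
  have h := hinv _ (one_sub_exp_neg_mem hy)
  rw [L_one_sub_exp_neg] at h
  rw [← h, invCdf_le_iff (one_sub_exp_neg_mem hy)]

/-- The quantile transformation, for the exponential law. -/
theorem eq_map_gammaLaw (hH : MemHStar H)
    (hinv : ∀ u ∈ Ioo (0 : ℝ) 1, invCdf μ u = H (L u)) : μ = (gammaLaw 0).map H := by
  have : IsProbabilityMeasure ((gammaLaw 0).map H) :=
    Measure.isProbabilityMeasure_map (hH.aemeasurable_gammaLaw 0)
  refine Measure.ext_of_Iic _ _ fun x => ?_
  have hm : AEMeasurable H (unifLaw.map L) := unifLaw_map_L ▸ hH.aemeasurable_gammaLaw 0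
  rw [← unifLaw_map_L, AEMeasurable.map_map_of_aemeasurable hm measurable_L.aemeasurable,
    Measure.map_apply_of_aemeasurable (hm.comp_measurable measurable_L) measurableSet_Iic,
    Measure.restrict_apply₀' measurableSet_Ioo.nullMeasurableSet]
  have h1 : (H ∘ L) ⁻¹' Iic x ∩ Ioo 0 1 = Iic (cdf μ x) ∩ Ioo 0 1 := by
    ext u
    refine and_congr_left fun hu => ?_
    rw [mem_preimage, mem_Iic, Function.comp, ← hinv u hu, invCdf_le_iff hu, mem_Iic]
  rw [h1, ← ofReal_cdf]
  rcases lt_or_ge (cdf μ x) 1 with h | h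
  · rw [← Measure.restrict_apply measurableSet_Iic]
    exact (unifLaw_Iic h).symm
  · have h2 : cdf μ x = 1 := le_antisymm (cdf_le_one μ x) h
    have h3 : Iic (1 : ℝ) ∩ Ioo 0 1 = Ioo 0 1 := inter_eq_right.2 fun u hu => hu.2.le
    rw [h2, h3]; simp

lemma integrable_gammaLaw_iff (n : ℕ) {f : ℝ → ℝ} :
    Integrable f (gammaLaw n) ↔
      IntegrableOn (fun y => y ^ n * Real.exp (-y) / n.factorial * f y) (Ioi 0) := by
  rw [gammaLaw, integrable_withDensity_iff_integrable_smul' (by fun_prop)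
    (ae_of_all _ fun _ => ENNReal.ofReal_lt_top)]
  refine integrable_congr ?_
  filter_upwards [ae_restrict_mem measurableSet_Ioi] with y hy
  have hy' : (0 : ℝ) < y := hy
  rw [ENNReal.toReal_ofReal (by positivity), smul_eq_mul]

lemma integral_gammaLaw (n : ℕ) (f : ℝ → ℝ) :
    ∫ y, f y ∂gammaLaw n =
      ∫ y in Ioi (0 : ℝ), y ^ n * Real.exp (-y) / n.factorial * f y := by
  rw [gammaLaw, integral_withDensity_eq_integral_toReal_smul (by fun_prop)
    (ae_of_all _ fun _ => ENNReal.ofReal_lt_top)]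
  refine setIntegral_congr_fun measurableSet_Ioi fun y hy => ?_
  have hy' : (0 : ℝ) < y := hy
  rw [ENNReal.toReal_ofReal (by positivity), smul_eq_mul]

lemma MemHStar.integrableOn_mul (hH : MemHStar H) (m : ℕ) :
    IntegrableOn (fun y => y ^ m * Real.exp (-y) * H y) (Ioi 0) := by
  have hm : AEStronglyMeasurable (fun y => y ^ m * Real.exp (-y) * H y)
      (volume.restrict (Ioi 0)) :=
    ((by fun_prop : Measurable fun y : ℝ => y ^ m * Real.exp (-y)).aemeasurable.mul
      hH.aemeasurable_restrict).aestronglyMeasurable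
  refine Integrable.mono (hH.integrable m) hm ?_
  refine ae_of_all _ fun y => ?_
  simp

lemma MemHStar.integrable_gammaLaw (hH : MemHStar H) (n : ℕ) : Integrable H (gammaLaw n) := by
  rw [integrable_gammaLaw_iff]
  refine ((hH.integrableOn_mul n).div_const (n.factorial : ℝ)).congr ?_
  exact ae_of_all _ fun y => by ring

end Quantile

/-! ### Expected records as gamma integrals of `H`. -/

section Record

variable {S : Type*} [MeasurableSpace S] {Q : Measure S} [IsProbabilityMeasure Q] {Y : ℕ → S → ℝ}
  {μ : Measure ℝ} {H : ℝ → ℝ}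

lemma record_ae_eq (hYm : ∀ i, Measurable (Y i)) (hYi : iIndepFun Y Q)
    (hYl : ∀ i, Q.map (Y i) = unifLaw) (hinv : ∀ u ∈ Ioo (0 : ℝ) 1, invCdf μ u = H (L u))
    (n : ℕ) : record μ Y n =ᵐ[Q] fun a => H (L (recordValue (fun i => Y i a) n)) := by
  filter_upwards [ae_recordValue_mem hYm hYi hYl n] with a ha
  exact hinv _ ha

lemma aemeasurable_L_recordValue (hYm : ∀ i, Measurable (Y i)) (hYi : iIndepFun Y Q)
    (hYl : ∀ i, Q.map (Y i) = unifLaw) (n : ℕ) :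
    AEMeasurable (fun a => L (recordValue (fun i => Y i a) n)) Q :=
  measurable_L.comp_aemeasurable (aemeasurable_recordValue hYm hYi hYl n)

lemma integrable_record (hYm : ∀ i, Measurable (Y i)) (hYi : iIndepFun Y Q)
    (hYl : ∀ i, Q.map (Y i) = unifLaw) (hH : MemHStar H)
    (hinv : ∀ u ∈ Ioo (0 : ℝ) 1, invCdf μ u = H (L u)) (n : ℕ) :
    Integrable (record μ Y n) Q := by
  rw [integrable_congr (record_ae_eq hYm hYi hYl hinv n)]
  have h := hH.integrable_gammaLaw n
  rw [← map_L_recordValue hYm hYi hYl n] at h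
  exact h.comp_aemeasurable (aemeasurable_L_recordValue hYm hYi hYl n)

lemma integral_comp_L_recordValue (hYm : ∀ i, Measurable (Y i)) (hYi : iIndepFun Y Q)
    (hYl : ∀ i, Q.map (Y i) = unifLaw) (n : ℕ) {f : ℝ → ℝ}
    (hf : AEStronglyMeasurable f (gammaLaw n)) :
    ∫ a, f (L (recordValue (fun i => Y i a) n)) ∂Q =
      ∫ y in Ioi (0 : ℝ), y ^ n * Real.exp (-y) / n.factorial * f y := by
  rw [← integral_gammaLaw, ← map_L_recordValue hYm hYi hYl n, integral_map
    (aemeasurable_L_recordValue hYm hYi hYl n)]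
  rwa [map_L_recordValue hYm hYi hYl n]

theorem expRecord_eq (hYm : ∀ i, Measurable (Y i)) (hYi : iIndepFun Y Q)
    (hYl : ∀ i, Q.map (Y i) = unifLaw) (hH : MemHStar H)
    (hinv : ∀ u ∈ Ioo (0 : ℝ) 1, invCdf μ u = H (L u)) (n : ℕ) :
    expRecord μ Y Q n = ∫ y in Ioi (0 : ℝ), y ^ n * Real.exp (-y) / n.factorial * H y := by
  rw [expRecord, integral_congr_ae (record_ae_eq hYm hYi hYl hinv n)]
  exact integral_comp_L_recordValue hYm hYi hYl n (hH.aemeasurable_gammaLaw n).aestronglyMeasurable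

theorem absRecord_eq (hYm : ∀ i, Measurable (Y i)) (hYi : iIndepFun Y Q)
    (hYl : ∀ i, Q.map (Y i) = unifLaw) (hH : MemHStar H)
    (hinv : ∀ u ∈ Ioo (0 : ℝ) 1, invCdf μ u = H (L u)) (n : ℕ) :
    absRecord μ Y Q n = ∫ y in Ioi (0 : ℝ), y ^ n * Real.exp (-y) / n.factorial * |H y| := by
  have h : (fun a => |record μ Y n a|) =ᵐ[Q]
      fun a => |H (L (recordValue (fun i => Y i a) n))| := by
    filter_upwards [record_ae_eq hYm hYi hYl hinv n] with a ha
    rw [ha]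
  rw [absRecord, integral_congr_ae h]
  exact integral_comp_L_recordValue hYm hYi hYl n (f := fun y => |H y|)
    (hH.aemeasurable_gammaLaw n).aestronglyMeasurable.norm

omit [IsProbabilityMeasure Q] in
lemma map_eq_unifLaw_of_isUniform {Z : S → ℝ} (h : pdf.IsUniform Z (Ioo (0 : ℝ) 1) Q volume) :
    Q.map Z = unifLaw := by
  have : Q.map Z = ProbabilityTheory.cond volume (Ioo (0 : ℝ) 1) := h
  rw [this, ProbabilityTheory.cond]
  simp

end Record

/-! ### The Stieltjes measure of `H` and integration by parts. -/

/-- The image under `L ∘ F` of the Lebesgue measure on `{x : 0 < F(x) < 1}`. It is the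
Lebesgue-Stieltjes measure of the function `H` with `F⁻¹ = H ∘ L`. -/
noncomputable def levelMeasure (μ : Measure ℝ) : Measure ℝ :=
  (volume.restrict {x | cdf μ x ∈ Ioo (0 : ℝ) 1}).map fun x => L (cdf μ x)

instance (μ : Measure ℝ) : SFinite (levelMeasure μ) := by
  unfold levelMeasure; infer_instance

section

variable {μ : Measure ℝ} {H : ℝ → ℝ}

lemma measurable_L_cdf (μ : Measure ℝ) : Measurable fun x => L (cdf μ x) :=
  measurable_L.comp (monotone_cdf μ).measurable

lemma measurableSet_cdf_mem (μ : Measure ℝ) : MeasurableSet {x | cdf μ x ∈ Ioo (0 : ℝ) 1} :=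
  (monotone_cdf μ).measurable measurableSet_Ioo

lemma levelMeasure_ae_pos (μ : Measure ℝ) : ∀ᵐ y ∂levelMeasure μ, 0 < y := by
  rw [levelMeasure, ae_map_iff (measurable_L_cdf μ).aemeasurable measurableSet_Ioi]
  filter_upwards [ae_restrict_mem (measurableSet_cdf_mem μ)] with x hx using L_pos hx

lemma exp_neg_L {u : ℝ} (hu : u < 1) : Real.exp (-L u) = 1 - u := by
  simp [L, Real.exp_log (show 0 < 1 - u by linarith)]

lemma le_L_iff {u a : ℝ} (hu : u < 1) : a ≤ L u ↔ 1 - Real.exp (-a) ≤ u := by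
  rw [← neg_le_neg_iff, ← Real.exp_le_exp, exp_neg_L hu]
  constructor <;> intro h <;> linarith

/-- By the Galois connection, `a ≤ L(F(x)) < b` amounts to `H a ≤ x < H b`. -/
lemma levelMeasure_Ico (hinv : ∀ u ∈ Ioo (0 : ℝ) 1, invCdf μ u = H (L u)) {a b : ℝ} (ha : 0 < a)
    (hab : a ≤ b) : levelMeasure μ (Ico a b) = ENNReal.ofReal (H b - H a) := by
  rw [levelMeasure, Measure.map_apply (measurable_L_cdf μ) measurableSet_Ico,
    Measure.restrict_apply (measurable_L_cdf μ measurableSet_Ico), ← Real.volume_Ico]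
  congr 1
  ext x
  have h1 := le_iff_of_invCdf hinv ha x
  have h2 := le_iff_of_invCdf hinv (ha.trans_le hab) x
  have h3 := one_sub_exp_neg_mem ha
  have h4 := one_sub_exp_neg_mem (ha.trans_le hab)
  simp only [mem_inter_iff, mem_preimage, mem_Ico, mem_ofPred_eq, h1]
  rw [← not_le, ← not_le, h2]
  constructor
  · rintro ⟨⟨h5, h6⟩, h7⟩
    rw [le_L_iff h7.2] at h5 h6
    exact ⟨h5, h6⟩
  · rintro ⟨h5, h6⟩
    have h7 : cdf μ x < 1 := (not_le.1 h6).trans h4.2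
    rw [le_L_iff h7, le_L_iff h7]
    exact ⟨⟨h5, h6⟩, h3.1.trans_le h5, h7⟩

lemma levelMeasure_real_Ico (hH : MonotoneOn H (Ioi 0))
    (hinv : ∀ u ∈ Ioo (0 : ℝ) 1, invCdf μ u = H (L u)) {a b : ℝ} (ha : 0 < a)
    (hab : a ≤ b) : (levelMeasure μ).real (Ico a b) = H b - H a := by
  rw [measureReal_def, levelMeasure_Ico hinv ha hab, ENNReal.toReal_ofReal]
  exact sub_nonneg.2 (hH ha (ha.trans_le hab) hab)

/-- Integration by parts against the Lebesgue-Stieltjes measure of `H`. -/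
theorem integral_levelMeasure (hH : MonotoneOn H (Ioi 0))
    (hinv : ∀ u ∈ Ioo (0 : ℝ) 1, invCdf μ u = H (L u)) {q q' : ℝ → ℝ}
    (hq : ∀ y, HasDerivAt q (q' y) y) (hq0 : q 0 = 0) (hqt : Tendsto q atTop (𝓝 0))
    (hq'm : Measurable q') (hq' : IntegrableOn q' (Ioi 0))
    (hHq : IntegrableOn (fun y => (H y - H 1) * q' y) (Ioi 0)) :
    Integrable q (levelMeasure μ) ∧
      ∫ y, q y ∂levelMeasure μ = -∫ y in Ioi (0 : ℝ), (H y - H 1) * q' y := by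
  set κ := levelMeasure μ with hκ
  -- `H y - H 1` is the mass of `[1, y)` if `y ≥ 1`, and minus the mass of `[y, 1)` if `y < 1`. The
  -- base point is interior because `H` may be unbounded near 0.
  let A : Set (ℝ × ℝ) := {p | 1 ≤ p.1 ∧ p.1 < p.2}
  let B : Set (ℝ × ℝ) := {p | p.2 ≤ p.1 ∧ p.1 < 1}
  have hA : MeasurableSet A := (measurableSet_le measurable_const measurable_fst).inter
    (measurableSet_lt measurable_fst measurable_snd)
  have hB : MeasurableSet B := (measurableSet_le measurable_snd measurable_fst).inter
    (measurableSet_lt measurable_fst measurable_const)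
  let Φ : ℝ × ℝ → ℝ := fun p => (A.indicator 1 p - B.indicator 1 p) * q' p.2
  have hΦ : Measurable Φ := ((measurable_one.indicator hA).sub (measurable_one.indicator hB)).mul
    (hq'm.comp measurable_snd)
  have hAs : ∀ x y : ℝ, A.indicator (1 : ℝ × ℝ → ℝ) (x, y) = (Ico 1 y).indicator 1 x :=
    fun x y => rfl
  have hBs : ∀ x y : ℝ, B.indicator (1 : ℝ × ℝ → ℝ) (x, y) = (Ico y 1).indicator 1 x :=
    fun x y => rfl
  have hfinA : ∀ y, 0 < y → Integrable ((Ico 1 y).indicator (1 : ℝ → ℝ)) κ := by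
    intro y hy
    refine (integrable_indicator_iff measurableSet_Ico).2 (integrableOn_const ?_)
    rcases le_total 1 y with h | h
    · rw [hκ, levelMeasure_Ico hinv one_pos h]; exact ENNReal.ofReal_ne_top
    · simp [Ico_eq_empty (not_lt.2 h)]
  have hfinB : ∀ y, 0 < y → Integrable ((Ico y 1).indicator (1 : ℝ → ℝ)) κ := by
    intro y hy
    refine (integrable_indicator_iff measurableSet_Ico).2 (integrableOn_const ?_)
    rcases le_total y 1 with h | h
    · rw [hκ, levelMeasure_Ico hinv hy h]; exact ENNReal.ofReal_ne_top
    · simp [Ico_eq_empty (not_lt.2 h)]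
  have hintA : ∀ y, ∫ x, (Ico 1 y).indicator (1 : ℝ → ℝ) x ∂κ = κ.real (Ico 1 y) := fun y =>
    integral_indicator_one measurableSet_Ico
  have hintB : ∀ y, ∫ x, (Ico y 1).indicator (1 : ℝ → ℝ) x ∂κ = κ.real (Ico y 1) := fun y =>
    integral_indicator_one measurableSet_Ico
  have hsec : ∀ y, 0 < y → ∫ x, Φ (x, y) ∂κ = (H y - H 1) * q' y := by
    intro y hy
    simp only [Φ, hAs, hBs]
    rw [integral_mul_const, integral_sub (hfinA y hy) (hfinB y hy), hintA, hintB]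
    congr 1
    rcases le_total 1 y with h | h
    · rw [hκ, levelMeasure_real_Ico hH hinv one_pos h, Ico_eq_empty (not_lt.2 h)]; simp
    · rw [hκ, levelMeasure_real_Ico hH hinv hy h, Ico_eq_empty (not_lt.2 h)]; simp
  -- For each `y` one of the two intervals is empty, so nothing cancels and the integrability of `(H
  -- - H 1) q'` passes to the product.
  have hsecn : ∀ y, 0 < y → ∫ x, ‖Φ (x, y)‖ ∂κ = ‖(H y - H 1) * q' y‖ := by
    intro y hy
    simp only [Φ, hAs, hBs, norm_mul]
    rw [integral_mul_const]
    congr 1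
    rcases le_total 1 y with h | h
    · rw [Ico_eq_empty (not_lt.2 h)]
      have : ∀ x, ‖(Ico 1 y).indicator (1 : ℝ → ℝ) x - (∅ : Set ℝ).indicator 1 x‖ =
          (Ico 1 y).indicator 1 x := by
        intro x
        rw [indicator_empty, sub_zero, Real.norm_of_nonneg]
        exact indicator_nonneg (fun _ _ => zero_le_one) _
      simp_rw [this]
      rw [hintA, hκ, levelMeasure_real_Ico hH hinv one_pos h, Real.norm_of_nonneg]
      exact sub_nonneg.2 (hH (mem_Ioi.2 one_pos) hy h)
    · rw [Ico_eq_empty (not_lt.2 h)]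
      have : ∀ x, ‖(∅ : Set ℝ).indicator (1 : ℝ → ℝ) x - (Ico y 1).indicator 1 x‖ =
          (Ico y 1).indicator 1 x := by
        intro x
        rw [indicator_empty, zero_sub, norm_neg, Real.norm_of_nonneg]
        exact indicator_nonneg (fun _ _ => zero_le_one) _
      simp_rw [this]
      rw [hintB, hκ, levelMeasure_real_Ico hH hinv hy h, Real.norm_of_nonpos, neg_sub]
      exact sub_nonpos.2 (hH hy (mem_Ioi.2 one_pos) h)
  have hint : Integrable Φ (κ.prod (volume.restrict (Ioi 0))) := by
    rw [integrable_prod_iff' hΦ.aestronglyMeasurable]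
    refine ⟨?_, ?_⟩
    · filter_upwards [ae_restrict_mem measurableSet_Ioi] with y hy
      exact ((hfinA y hy).sub (hfinB y hy)).mul_const (q' y)
    · refine hHq.norm.congr ?_
      filter_upwards [ae_restrict_mem measurableSet_Ioi] with y hy
      exact (hsecn y hy).symm
  -- The inner integral of `q'` runs over `(x, ∞)` or, with a minus sign, over `(0, x]`. As `q`
  -- vanishes at both ends, the result is the same.
  have hother : ∀ x, 0 < x → ∫ y in Ioi (0 : ℝ), Φ (x, y) = -q x := by
    intro x hx
    rcases le_or_gt 1 x with h | h
    · have : ∀ y, Φ (x, y) = (Ioi x).indicator q' y := by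
        intro y
        have hb : (x, y) ∉ B := fun hb => absurd hb.2 (not_lt.2 h)
        simp only [Φ]
        rw [indicator_of_notMem hb, sub_zero]
        by_cases hy : x < y
        · rw [indicator_of_mem (show (x, y) ∈ A from ⟨h, hy⟩), indicator_of_mem (by exact hy)]
          simp
        · rw [indicator_of_notMem (show (x, y) ∉ A from fun ha => hy ha.2),
            indicator_of_notMem (by exact hy), zero_mul]
      simp_rw [this]
      rw [integral_indicator measurableSet_Ioi, Measure.restrict_restrict measurableSet_Ioi,
        inter_eq_left.2 (Ioi_subset_Ioi hx.le),
        integral_Ioi_of_hasDerivAt_of_tendsto' (fun y _ => hq y)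
          (hq'.mono_set (Ioi_subset_Ioi hx.le)) hqt, zero_sub]
    · have : ∀ y, Φ (x, y) = -(Iic x).indicator q' y := by
        intro y
        have ha : (x, y) ∉ A := fun ha => absurd ha.1 (not_le.2 h)
        simp only [Φ]
        rw [indicator_of_notMem ha, zero_sub]
        by_cases hy : y ≤ x
        · rw [indicator_of_mem (show (x, y) ∈ B from ⟨hy, h⟩), indicator_of_mem (by exact hy)]
          simp
        · rw [indicator_of_notMem (show (x, y) ∉ B from fun ha => hy ha.1),
            indicator_of_notMem (by exact hy), neg_zero, zero_mul]
      simp_rw [this]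
      rw [integral_neg, integral_indicator measurableSet_Iic,
        Measure.restrict_restrict measurableSet_Iic, inter_comm, Ioi_inter_Iic,
        ← intervalIntegral.integral_of_le hx.le,
        intervalIntegral.integral_eq_sub_of_hasDerivAt (fun y _ => hq y), hq0, sub_zero]
      rw [intervalIntegrable_iff_integrableOn_Ioc_of_le hx.le]
      exact hq'.mono_set Ioc_subset_Ioi_self
  have hae : (fun x => ∫ y in Ioi (0 : ℝ), Φ (x, y)) =ᵐ[κ] fun x => -q x := by
    filter_upwards [levelMeasure_ae_pos μ] with x hx using hother x hx
  refine ⟨?_, ?_⟩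
  · have := (hint.integral_prod_left.congr hae).neg
    simpa using this
  · have h1 := integral_integral_swap (f := fun x y => Φ (x, y)) hint
    rw [integral_congr_ae hae, integral_neg, setIntegral_congr_fun measurableSet_Ioi
      (fun y hy => hsec y hy)] at h1
    linarith

lemma hasDerivAt_pow_mul_exp_neg (n : ℕ) (y : ℝ) :
    HasDerivAt (fun y => y ^ (n + 1) * Real.exp (-y))
      ((n + 1) * (y ^ n * Real.exp (-y)) - y ^ (n + 1) * Real.exp (-y)) y := by
  have := (hasDerivAt_pow (n + 1) y).mul (hasDerivAt_neg y).exp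
  refine this.congr_deriv ?_
  push_cast
  ring

/-- The derivative of `y^(n+1) e^{-y}` is `(n+1)!` times a difference of two gamma densities. Both
have mass one, so the constant `H 1` drops out. -/
lemma integral_levelMeasure_pow (hH : MemHStar H)
    (hinv : ∀ u ∈ Ioo (0 : ℝ) 1, invCdf μ u = H (L u)) (n : ℕ) :
    Integrable (fun y => y ^ (n + 1) * Real.exp (-y)) (levelMeasure μ) ∧
      ∫ y, y ^ (n + 1) * Real.exp (-y) ∂levelMeasure μ = (n + 1).factorial *
        ((∫ y in Ioi (0 : ℝ), y ^ (n + 1) * Real.exp (-y) / (n + 1).factorial * H y) -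
          ∫ y in Ioi (0 : ℝ), y ^ n * Real.exp (-y) / n.factorial * H y) := by
  have i1 := hH.integrableOn_mul n
  have i2 := hH.integrableOn_mul (n + 1)
  have i3 := integrableOn_pow_mul_exp_neg n
  have i4 := integrableOn_pow_mul_exp_neg (n + 1)
  have e : ∀ y, (H y - H 1) * ((n + 1) * (y ^ n * Real.exp (-y)) - y ^ (n + 1) * Real.exp (-y)) =
      ((n + 1) * (y ^ n * Real.exp (-y) * H y) - y ^ (n + 1) * Real.exp (-y) * H y) -
      H 1 * ((n + 1) * (y ^ n * Real.exp (-y)) - y ^ (n + 1) * Real.exp (-y)) := fun y => by ring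
  have i5 : IntegrableOn (fun y => (n + 1) * (y ^ n * Real.exp (-y) * H y) -
      y ^ (n + 1) * Real.exp (-y) * H y) (Ioi 0) := (i1.const_mul _).sub i2
  have i6 : IntegrableOn (fun y => (n + 1) * (y ^ n * Real.exp (-y)) -
      y ^ (n + 1) * Real.exp (-y)) (Ioi 0) := (i3.const_mul _).sub i4
  have h := integral_levelMeasure hH.mono hinv (hasDerivAt_pow_mul_exp_neg n) (by simp)
    (Real.tendsto_pow_mul_exp_neg_atTop_nhds_zero (n + 1)) (by fun_prop) i6 (by
      simp_rw [e]; exact i5.sub (i6.const_mul _))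
  refine ⟨h.1, h.2.trans ?_⟩
  simp_rw [e]
  rw [integral_sub i5 (i6.const_mul _), integral_const_mul, integral_sub (i1.const_mul _) i2,
    integral_sub (i3.const_mul _) i4, integral_const_mul, integral_const_mul,
    integral_pow_mul_exp_neg, integral_pow_mul_exp_neg]
  have e2 : ∀ (m : ℕ), ∫ y in Ioi (0 : ℝ), y ^ m * Real.exp (-y) / m.factorial * H y =
      (∫ y in Ioi (0 : ℝ), y ^ m * Real.exp (-y) * H y) / m.factorial := by
    intro m
    rw [← integral_div]
    congr 1
    ext y
    ring
  rw [e2, e2, Nat.factorial_succ]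
  have : (n.factorial : ℝ) ≠ 0 := by positivity
  push_cast
  field_simp
  ring

lemma weight_eq_zero (μ : Measure ℝ) {x : ℝ} (hx : x ∉ {x | cdf μ x ∈ Ioo (0 : ℝ) 1}) :
    weight μ x = 0 := by
  rw [weight]
  rcases (cdf_nonneg μ x).eq_or_lt with h | h
  · simp [← h, L]
  · have : cdf μ x = 1 := by
      refine le_antisymm (cdf_le_one μ x) ?_
      by_contra! h'
      exact hx ⟨h, h'⟩
    simp [this]

lemma weight_eq (μ : Measure ℝ) {x : ℝ} (hx : cdf μ x ∈ Ioo (0 : ℝ) 1) :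
    weight μ x = L (cdf μ x) * Real.exp (-L (cdf μ x)) := by
  rw [weight, exp_neg_L hx.2, mul_comm]

lemma integral_weight (μ : Measure ℝ) :
    ∫ x, weight μ x = ∫ y, y * Real.exp (-y) ∂levelMeasure μ := by
  rw [levelMeasure, integral_map (measurable_L_cdf μ).aemeasurable (by fun_prop),
    ← setIntegral_congr_fun (measurableSet_cdf_mem μ) (fun x hx => weight_eq μ hx)]
  exact (setIntegral_eq_integral_of_forall_compl_eq_zero fun x hx => weight_eq_zero μ hx).symm

/-- The density of `V` depends on `x` only through `L(F(x))` and vanishes where `F` is 0 or 1, so it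
factors through the image measure. -/
theorem phi_eq_withDensity (μ : Measure ℝ) :
    phi μ = (levelMeasure μ).withDensity
      fun y => ENNReal.ofReal (y * Real.exp (-y) / ∫ x, weight μ x) := by
  set C := ∫ x, weight μ x with hC
  ext B hB
  have hpre := measurable_L_cdf μ hB
  rw [phi, Measure.map_apply (measurable_L_cdf μ) hB, lawV, withDensity_apply _ hpre,
    withDensity_apply _ hB, levelMeasure, setLIntegral_map hB (by fun_prop) (measurable_L_cdf μ),
    Measure.restrict_restrict hpre, ← hC, inter_comm,
    ← Measure.restrict_restrict (measurableSet_cdf_mem μ),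
    ← lintegral_indicator (measurableSet_cdf_mem μ)]
  refine lintegral_congr fun x => ?_
  by_cases hx : x ∈ {x | cdf μ x ∈ Ioo (0 : ℝ) 1}
  · rw [indicator_of_mem hx, weight_eq μ hx]
  · rw [indicator_of_notMem hx, weight_eq_zero μ hx]; simp

end

/-! ### Moments of `φ(X)`. -/

section

variable {μ : Measure ℝ} {H : ℝ → ℝ}

/-- The integral that gives the expected `(n+1)`-st record of the law with inverse distribution
function `H ∘ L`. -/
noncomputable def recordMean (H : ℝ → ℝ) (n : ℕ) : ℝ :=
  ∫ y in Ioi (0 : ℝ), y ^ n * Real.exp (-y) / n.factorial * H y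

lemma MemHStar.integrableOn_div_mul {H : ℝ → ℝ} (hH : MemHStar H) (n : ℕ) :
    IntegrableOn (fun y => y ^ n * Real.exp (-y) / n.factorial * H y) (Ioi 0) :=
  (integrable_gammaLaw_iff n).1 (hH.integrable_gammaLaw n)

lemma integral_weight_eq (hH : MemHStar H)
    (hinv : ∀ u ∈ Ioo (0 : ℝ) 1, invCdf μ u = H (L u)) :
    ∫ x, weight μ x = recordMean H 1 - recordMean H 0 := by
  have h := (integral_levelMeasure_pow hH hinv 0).2
  rw [integral_weight]
  simp only [zero_add, pow_one, Nat.factorial_one, Nat.cast_one, one_mul] at h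
  rw [h, recordMean, recordMean]
  simp

lemma levelMeasure_ne_zero (hH : MemHStar H)
    (hinv : ∀ u ∈ Ioo (0 : ℝ) 1, invCdf μ u = H (L u)) : levelMeasure μ ≠ 0 := by
  obtain ⟨x, hx, y, hy, hne⟩ := hH.nonconst
  wlog hxy : x ≤ y generalizing x y
  · exact this y hy x hx hne.symm (le_of_not_ge hxy)
  intro h0
  have h1 := levelMeasure_real_Ico hH.mono hinv hx hxy
  rw [h0] at h1
  simp only [measureReal_zero_apply] at h1
  exact hne (by linarith)

/-- The integrand `y e^{-y}` is positive almost everywhere for `dH`, and `dH` is nonzero because `H`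
is not constant. This is what yields `ρ_1 < ρ_2`. -/
lemma integral_weight_pos (hH : MemHStar H)
    (hinv : ∀ u ∈ Ioo (0 : ℝ) 1, invCdf μ u = H (L u)) : 0 < ∫ x, weight μ x := by
  have hi := (integral_levelMeasure_pow hH hinv 0).1
  simp only [zero_add, pow_one] at hi
  have hpos : ∀ᵐ y ∂levelMeasure μ, 0 < y * Real.exp (-y) := by
    filter_upwards [levelMeasure_ae_pos μ] with y hy
    positivity
  have hnn : 0 ≤ᵐ[levelMeasure μ] fun y => y * Real.exp (-y) := hpos.mono fun y hy => hy.le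
  rw [integral_weight]
  refine lt_of_le_of_ne (integral_nonneg_of_ae hnn) fun h => ?_
  have h0 := (integral_eq_zero_iff_of_nonneg_ae hnn hi).1 h.symm
  have : ∀ᵐ y ∂levelMeasure μ, False := by
    filter_upwards [h0, hpos] with y h1 h2
    rw [h1] at h2
    exact lt_irrefl _ h2
  exact levelMeasure_ne_zero hH hinv (by simpa [ae_iff] using this)

lemma recordMean_lt (hH : MemHStar H)
    (hinv : ∀ u ∈ Ioo (0 : ℝ) 1, invCdf μ u = H (L u)) : recordMean H 0 < recordMean H 1 := by
  have := integral_weight_pos hH hinv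
  rw [integral_weight_eq hH hinv] at this
  linarith

lemma phi_ae_pos (μ : Measure ℝ) : ∀ᵐ y ∂phi μ, 0 < y := by
  rw [phi_eq_withDensity]
  exact (withDensity_absolutelyContinuous _ _).ae_le (levelMeasure_ae_pos μ)

lemma integrable_phi_iff (hC : 0 < ∫ x, weight μ x) {f : ℝ → ℝ} :
    Integrable f (phi μ) ↔
      Integrable (fun y => y * Real.exp (-y) / (∫ x, weight μ x) * f y) (levelMeasure μ) := by
  rw [phi_eq_withDensity, integrable_withDensity_iff_integrable_smul' (by fun_prop)
    (ae_of_all _ fun _ => ENNReal.ofReal_lt_top)]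
  refine integrable_congr ?_
  filter_upwards [levelMeasure_ae_pos μ] with y hy
  rw [ENNReal.toReal_ofReal (by positivity), smul_eq_mul]

lemma integral_phi (hC : 0 < ∫ x, weight μ x) (f : ℝ → ℝ) :
    ∫ y, f y ∂phi μ = ∫ y, y * Real.exp (-y) / (∫ x, weight μ x) * f y ∂levelMeasure μ := by
  rw [phi_eq_withDensity, integral_withDensity_eq_integral_toReal_smul (by fun_prop)
    (ae_of_all _ fun _ => ENNReal.ofReal_lt_top)]
  refine integral_congr_ae ?_
  filter_upwards [levelMeasure_ae_pos μ] with y hy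
  rw [ENNReal.toReal_ofReal (by positivity), smul_eq_mul]

lemma integrable_pow_phi (hH : MemHStar H)
    (hinv : ∀ u ∈ Ioo (0 : ℝ) 1, invCdf μ u = H (L u)) (n : ℕ) :
    Integrable (fun y => y ^ n) (phi μ) := by
  rw [integrable_phi_iff (integral_weight_pos hH hinv)]
  refine ((integral_levelMeasure_pow hH hinv n).1.div_const (∫ x, weight μ x)).congr ?_
  exact ae_of_all _ fun y => by ring

/-- The moments of `φ(X)` in terms of the expected records of `X`. -/
theorem integral_pow_phi (hH : MemHStar H)
    (hinv : ∀ u ∈ Ioo (0 : ℝ) 1, invCdf μ u = H (L u)) (n : ℕ) :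
    ∫ y, y ^ n ∂phi μ = (n + 1).factorial * (recordMean H (n + 1) - recordMean H n) /
      (recordMean H 1 - recordMean H 0) := by
  rw [integral_phi (integral_weight_pos hH hinv), ← integral_weight_eq hH hinv, recordMean,
    recordMean, ← (integral_levelMeasure_pow hH hinv n).2, ← integral_div]
  congr 1
  ext y
  ring

theorem isProbabilityMeasure_phi (hH : MemHStar H)
    (hinv : ∀ u ∈ Ioo (0 : ℝ) 1, invCdf μ u = H (L u)) : IsProbabilityMeasure (phi μ) := by
  have hi := (integral_levelMeasure_pow hH hinv 0).1
  have hC := integral_weight_pos hH hinv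
  simp only [zero_add, pow_one] at hi
  constructor
  rw [phi_eq_withDensity, withDensity_apply _ MeasurableSet.univ, Measure.restrict_univ,
    ← ofReal_integral_eq_lintegral_ofReal (hi.div_const _), integral_div, ← integral_weight,
    div_self hC.ne', ENNReal.ofReal_one]
  filter_upwards [levelMeasure_ae_pos μ] with y hy
  simp only [Pi.zero_apply]
  positivity

theorem lawT_phi (hH : MemHStar H)
    (hinv : ∀ u ∈ Ioo (0 : ℝ) 1, invCdf μ u = H (L u)) : LawT (phi μ) := by
  have := isProbabilityMeasure_phi hH hinv
  refine ⟨this, ?_, integrable_pow_phi hH hinv⟩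
  exact (prob_compl_eq_zero_iff measurableSet_Ioi).1 (phi_ae_pos μ)

/-- The increments of `H` in terms of `φ(X)`. -/
theorem sub_eq_setIntegral_phi (hH : MemHStar H)
    (hinv : ∀ u ∈ Ioo (0 : ℝ) 1, invCdf μ u = H (L u)) {a b : ℝ} (ha : 0 < a) (hab : a ≤ b) :
    H b - H a = (recordMean H 1 - recordMean H 0) *
      ∫ y in Ico a b, Real.exp y / y ∂phi μ := by
  have hC := integral_weight_pos hH hinv
  rw [← levelMeasure_real_Ico hH.mono hinv ha hab, ← integral_indicator measurableSet_Ico,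
    integral_phi hC, ← integral_weight_eq hH hinv, ← integral_const_mul,
    ← integral_indicator_one measurableSet_Ico]
  refine integral_congr_ae ?_
  filter_upwards [levelMeasure_ae_pos μ] with y hy
  by_cases h : y ∈ Ico a b
  · rw [indicator_of_mem h, indicator_of_mem h, Real.exp_neg]
    have := hC.ne'
    have h2 := hy.ne'
    simp only [Pi.one_apply]
    field_simp
  · rw [indicator_of_notMem h, indicator_of_notMem h]; simp

end

/-! ### Exponential integrability and geometric growth. -/

lemma summable_iff_tsum_ofReal_ne_top {a : ℕ → ℝ} (ha : ∀ n, 0 ≤ a n) :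
    Summable a ↔ ∑' n, ENNReal.ofReal (a n) ≠ ∞ := by
  refine ⟨fun h => h.tsum_ofReal_ne_top, fun h => ?_⟩
  have := ENNReal.summable_toReal h
  simpa [ENNReal.toReal_ofReal, ha] using this

/-- Tonelli for the exponential series, all of whose terms are nonnegative. It serves both for `M_T`
(with `f = 1`) and for `G_w` (with `f = e^{-y} |H|`). -/
lemma integrable_exp_mul_iff_summable {ν : Measure ℝ} {f : ℝ → ℝ} (hν : ∀ᵐ y ∂ν, 0 < y)
    (hf : ∀ y, 0 ≤ f y) (hint : ∀ n : ℕ, Integrable (fun y => y ^ n * f y) ν) {t : ℝ}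
    (ht : 0 ≤ t) : Integrable (fun y => Real.exp (t * y) * f y) ν ↔
      Summable fun n : ℕ => t ^ n / n.factorial * ∫ y, y ^ n * f y ∂ν := by
  have hfi : Integrable f ν := by simpa using hint 0
  have hm : AEStronglyMeasurable (fun y => Real.exp (t * y) * f y) ν :=
    (by fun_prop : Measurable fun y : ℝ => Real.exp (t * y)).aestronglyMeasurable.mul
      hfi.aestronglyMeasurable
  have hnn : ∀ n : ℕ, 0 ≤ᵐ[ν] fun y => y ^ n * f y := fun n => by
    filter_upwards [hν] with y hy
    exact mul_nonneg (pow_nonneg hy.le n) (hf y)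
  rw [summable_iff_tsum_ofReal_ne_top
    fun n => mul_nonneg (by positivity) (integral_nonneg_of_ae (hnn n))]
  have hlin : ∫⁻ y, ENNReal.ofReal (Real.exp (t * y) * f y) ∂ν =
      ∑' n : ℕ, ENNReal.ofReal (t ^ n / n.factorial * ∫ y, y ^ n * f y ∂ν) := by
    have h1 : ∀ n : ℕ, ENNReal.ofReal (t ^ n / n.factorial * ∫ y, y ^ n * f y ∂ν) =
        ∫⁻ y, ENNReal.ofReal (t ^ n / n.factorial * (y ^ n * f y)) ∂ν := by
      intro n
      rw [← integral_const_mul, ofReal_integral_eq_lintegral_ofReal ((hint n).const_mul _)]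
      filter_upwards [hnn n] with y hy
      exact mul_nonneg (by positivity) hy
    simp_rw [h1]
    rw [← lintegral_tsum fun n => (((hint n).const_mul _).aestronglyMeasurable.aemeasurable).ennreal_ofReal]
    refine lintegral_congr_ae ?_
    filter_upwards [hν] with y hy
    have hs : HasSum (fun n : ℕ => t ^ n / n.factorial * (y ^ n * f y))
        (Real.exp (t * y) * f y) := by
      have := (NormedSpace.expSeries_div_hasSum_exp (t * y)).mul_right (f y)
      rw [← Real.exp_eq_exp_ℝ] at this
      refine this.congr_fun fun n => ?_
      rw [mul_pow]; ring
    rw [← hs.tsum_eq, ENNReal.ofReal_tsum_of_nonneg _ hs.summable]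
    intro n
    have := hf y
    positivity
  rw [← hlin]
  constructor
  · intro h
    exact (hasFiniteIntegral_iff_ofReal
      (ae_of_all _ fun y => mul_nonneg (Real.exp_pos _).le (hf y))).1 h.hasFiniteIntegral |>.ne
  · intro h
    exact ⟨hm, (hasFiniteIntegral_iff_ofReal
      (ae_of_all _ fun y => mul_nonneg (Real.exp_pos _).le (hf y))).2 h.lt_top⟩

/-- At most geometric growth. -/
def GeomBdd (a : ℕ → ℝ) : Prop := ∃ M b : ℝ, 0 ≤ M ∧ 0 < b ∧ ∀ n, |a n| ≤ M * b ^ n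

lemma GeomBdd.summable {a : ℕ → ℝ} (h : GeomBdd a) :
    ∃ ε : ℝ, 0 < ε ∧ ∀ t : ℝ, |t| < ε → Summable fun n => |a n * t ^ n| := by
  obtain ⟨M, b, hM, hb, hab⟩ := h
  refine ⟨b⁻¹, inv_pos.2 hb, fun t ht => ?_⟩
  have hbt : b * |t| < 1 := by
    have := mul_lt_mul_of_pos_left ht hb
    rwa [mul_inv_cancel₀ hb.ne'] at this
  have hs := (summable_geometric_of_lt_one (by positivity) hbt).mul_left M
  refine hs.of_nonneg_of_le (fun n => abs_nonneg _) fun n => ?_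
  rw [abs_mul, abs_pow, mul_pow, ← mul_assoc]
  exact mul_le_mul_of_nonneg_right (hab n) (by positivity)

lemma GeomBdd.of_summable {a : ℕ → ℝ} {t : ℝ} (ht : 0 < t) (h : Summable fun n => a n * t ^ n) :
    GeomBdd a := by
  obtain ⟨M, hM⟩ := h.tendsto_atTop_zero.norm.bddAbove_range
  have hM' : ∀ n, |a n * t ^ n| ≤ M := fun n => hM ⟨n, rfl⟩
  refine ⟨M, t⁻¹, (abs_nonneg _).trans (hM' 0), inv_pos.2 ht, fun n => ?_⟩
  have := hM' n
  rw [abs_mul, abs_of_pos (pow_pos ht n)] at this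
  rw [inv_pow, ← div_eq_mul_inv, le_div_iff₀ (pow_pos ht n)]
  exact this

lemma GeomBdd.mono {a b : ℕ → ℝ} (hb : GeomBdd b) (h : ∀ n, |a n| ≤ |b n|) : GeomBdd a := by
  obtain ⟨M, c, hM, hc, hbc⟩ := hb
  exact ⟨M, c, hM, hc, fun n => (h n).trans (hbc n)⟩

lemma GeomBdd.of_diff {r : ℕ → ℝ} (h : GeomBdd fun n => r (n + 1) - r n) : GeomBdd r := by
  obtain ⟨M, b, hM, hb, h⟩ := h
  have hK : 0 ≤ |r 0| + M := by positivity
  -- With base `b + 2`, one step of the recursion has room for two copies of the bound: one for `r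
  -- n`, one for the increment.
  refine ⟨|r 0| + M, b + 2, hK, by positivity, fun n => ?_⟩
  induction n with
  | zero => simpa using hM
  | succ n ih =>
    have h1 : |r (n + 1)| ≤ |r n| + |r (n + 1) - r n| := by
      have := abs_add_le (r n) (r (n + 1) - r n)
      rwa [add_sub_cancel] at this
    have h2 : M * b ^ n ≤ (|r 0| + M) * (b + 2) ^ n := by
      have : b ^ n ≤ (b + 2) ^ n := pow_le_pow_left₀ hb.le (by linarith) n
      exact mul_le_mul (by linarith [abs_nonneg (r 0)]) this (by positivity) hK
    have h3 : 0 ≤ (|r 0| + M) * (b + 2) ^ n := by positivity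
    have h4 : 0 ≤ (|r 0| + M) * (b + 2) ^ n * b := by positivity
    rw [pow_succ, ← mul_assoc]
    nlinarith [h n]

lemma GeomBdd.diff {r : ℕ → ℝ} (h : GeomBdd r) :
    GeomBdd fun n => ((n : ℝ) + 1) * (r (n + 1) - r n) := by
  obtain ⟨M, b, hM, hb, h⟩ := h
  -- Doubling the base pays for the factor `n + 1 ≤ 2 ^ n`.
  refine ⟨M * b + M, 2 * b, by positivity, by positivity, fun n => ?_⟩
  have h1 : |r (n + 1) - r n| ≤ (M * b + M) * b ^ n := by
    refine (abs_sub _ _).trans ?_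
    have := add_le_add (h (n + 1)) (h n)
    rw [pow_succ] at this
    linarith
  have h2 : (n : ℝ) + 1 ≤ 2 ^ n := by
    have := Nat.lt_two_pow_self (n := n)
    exact_mod_cast this
  rw [abs_mul, abs_of_nonneg (by positivity : (0 : ℝ) ≤ (n : ℝ) + 1), mul_pow]
  calc ((n : ℝ) + 1) * |r (n + 1) - r n| ≤ 2 ^ n * ((M * b + M) * b ^ n) :=
        mul_le_mul h2 h1 (abs_nonneg _) (by positivity)
    _ = _ := by ring

/-! ### The four equivalent conditions. -/

section

variable {μ : Measure ℝ} {H : ℝ → ℝ}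

/-- The integral that gives the expected absolute value of the `(n+1)`-st record. -/
noncomputable def recordAbsMean (H : ℝ → ℝ) (n : ℕ) : ℝ :=
  ∫ y in Ioi (0 : ℝ), y ^ n * Real.exp (-y) / n.factorial * |H y|

lemma MemHStar.integrableOn_div_mul_abs (hH : MemHStar H) (n : ℕ) :
    IntegrableOn (fun y => y ^ n * Real.exp (-y) / n.factorial * |H y|) (Ioi 0) :=
  (integrable_gammaLaw_iff n).1 (hH.integrable_gammaLaw n).abs

lemma abs_recordMean_le (H : ℝ → ℝ) (n : ℕ) : |recordMean H n| ≤ recordAbsMean H n := by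
  refine (abs_integral_le_integral_abs).trans_eq ?_
  refine setIntegral_congr_fun measurableSet_Ioi fun y hy => ?_
  have hy' : (0 : ℝ) < y := hy
  rw [abs_mul, abs_of_nonneg (by positivity)]

lemma MemHStar.abs_le_of_one_le (hH : MemHStar H) {y : ℝ} (hy : 1 ≤ y) :
    |H y| ≤ max (H y) 0 + |H 1| := by
  have h1 : H 1 ≤ H y := hH.mono (mem_Ioi.2 one_pos) (mem_Ioi.2 (one_pos.trans_le hy)) hy
  rcases le_total 0 (H y) with h | h
  · rw [abs_of_nonneg h, max_eq_left h]; linarith [abs_nonneg (H 1)]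
  · rw [abs_of_nonpos h, max_eq_right h]; linarith [neg_abs_le (H 1)]

/-- The error is independent of `n`: on `[1, ∞)` the negative part of `H` is at most `|H 1|`, and on
`(0, 1]` every gamma density is at most `e^{-y}`. -/
lemma recordAbsMean_le (hH : MemHStar H) (n : ℕ) :
    recordAbsMean H n ≤ recordMean H n + 2 * (|H 1| + recordAbsMean H 0) := by
  have i1 := hH.integrableOn_div_mul_abs n
  have i2 := hH.integrableOn_div_mul n
  have i3 := hH.integrableOn_div_mul_abs 0
  have i4 := (integrableOn_pow_mul_exp_neg n).div_const (n.factorial : ℝ)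
  have hone : ∫ y in Ioi (0 : ℝ), y ^ n * Real.exp (-y) / n.factorial = 1 := by
    rw [integral_div, integral_pow_mul_exp_neg, div_self (by positivity)]
  calc recordAbsMean H n
      ≤ ∫ y in Ioi (0 : ℝ), (y ^ n * Real.exp (-y) / n.factorial * H y +
          2 * (y ^ n * Real.exp (-y) / n.factorial * |H 1| +
            y ^ 0 * Real.exp (-y) / (Nat.factorial 0) * |H y|)) := by
        refine setIntegral_mono_on i1 (i2.add (((i4.mul_const _).add i3).const_mul 2))
          measurableSet_Ioi fun y hy => ?_
        have hy' : (0 : ℝ) < y := hy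
        set g := y ^ n * Real.exp (-y) / n.factorial with hg
        have hg0 : 0 ≤ g := by positivity
        simp only [pow_zero, Nat.factorial_zero, Nat.cast_one, div_one, one_mul]
        rcases le_total 1 y with h | h
        · have h1 := hH.abs_le_of_one_le h
          have h2 : max (H y) 0 = (|H y| + H y) / 2 := by
            rcases le_total 0 (H y) with h | h
            · rw [abs_of_nonneg h, max_eq_left h]; ring
            · rw [abs_of_nonpos h, max_eq_right h]; ring
          have h3 : |H y| ≤ H y + 2 * |H 1| := by linarith
          have h4 := mul_le_mul_of_nonneg_left h3 hg0
          have h5 : 0 ≤ Real.exp (-y) * |H y| := by positivity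
          linarith
        · have h1 : g ≤ Real.exp (-y) := by
            rw [hg, div_le_iff₀ (by positivity), mul_comm]
            refine mul_le_mul_of_nonneg_left ?_ (Real.exp_pos _).le
            refine (pow_le_one₀ hy'.le h).trans ?_
            exact_mod_cast n.factorial_pos
          have h2 : |H y| - H y ≤ 2 * |H y| := by linarith [neg_abs_le (H y)]
          have h3 : g * (|H y| - H y) ≤ Real.exp (-y) * (2 * |H y|) :=
            mul_le_mul h1 h2 (by linarith [le_abs_self (H y)]) (Real.exp_pos _).le
          have h4 : 0 ≤ g * |H 1| := by positivity
          linarith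
    _ = _ := by
        have i5 : IntegrableOn (fun y => y ^ n * Real.exp (-y) / n.factorial * |H 1| +
            y ^ 0 * Real.exp (-y) / (Nat.factorial 0) * |H y|) (Ioi 0) := (i4.mul_const _).add i3
        rw [integral_add i2 (i5.const_mul 2), integral_const_mul,
          integral_add (i4.mul_const _) i3, integral_mul_const, hone, one_mul]
        rfl

lemma geomBdd_recordMean_iff (hH : MemHStar H) :
    GeomBdd (recordMean H) ↔ GeomBdd (recordAbsMean H) := by
  refine ⟨?_, fun h => h.mono fun n => (abs_recordMean_le H n).trans (le_abs_self _)⟩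
  rintro ⟨M, b, hM, hb, h⟩
  have hnn : ∀ n, 0 ≤ recordAbsMean H n := fun n => (abs_nonneg _).trans (abs_recordMean_le H n)
  have hD : 0 ≤ 2 * (|H 1| + recordAbsMean H 0) := by linarith [abs_nonneg (H 1), hnn 0]
  -- A base of at least 1 absorbs the additive constant.
  refine ⟨M + 2 * (|H 1| + recordAbsMean H 0), b + 1, by linarith, by linarith, fun n => ?_⟩
  rw [abs_of_nonneg (hnn n)]
  have h1 : b ^ n ≤ (b + 1) ^ n := pow_le_pow_left₀ hb.le (by linarith) n
  have h2 : 1 ≤ (b + 1) ^ n := one_le_pow₀ (by linarith)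
  have h3 := (le_abs_self _).trans (h n)
  have h4 := recordAbsMean_le hH n
  have h5 := mul_le_mul_of_nonneg_left h1 hM
  have h6 := mul_le_mul_of_nonneg_left h2 hD
  linarith

lemma integrable_exp_phi_iff_summable (hH : MemHStar H)
    (hinv : ∀ u ∈ Ioo (0 : ℝ) 1, invCdf μ u = H (L u)) {t : ℝ} (ht : 0 ≤ t) :
    Integrable (fun y => Real.exp (t * y)) (phi μ) ↔
      Summable fun n : ℕ => (∫ y, y ^ n ∂phi μ) / n.factorial * t ^ n := by
  have := integrable_exp_mul_iff_summable (ν := phi μ) (f := fun _ => 1) (phi_ae_pos μ)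
    (fun _ => zero_le_one) (fun n => by simpa using integrable_pow_phi hH hinv n) ht
  simp only [mul_one] at this
  rw [this]
  exact summable_congr fun n => by ring

lemma moment_phi_div_factorial (hH : MemHStar H)
    (hinv : ∀ u ∈ Ioo (0 : ℝ) 1, invCdf μ u = H (L u)) (n : ℕ) :
    (∫ y, y ^ n ∂phi μ) / n.factorial = (n + 1) * (recordMean H (n + 1) - recordMean H n) /
      (recordMean H 1 - recordMean H 0) := by
  have hC : recordMean H 1 - recordMean H 0 ≠ 0 := (sub_pos.2 (recordMean_lt hH hinv)).ne'
  have : (n.factorial : ℝ) ≠ 0 := by positivity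
  rw [integral_pow_phi hH hinv, Nat.factorial_succ]
  push_cast
  field_simp

lemma geomBdd_recordMean_iff_moment (hH : MemHStar H)
    (hinv : ∀ u ∈ Ioo (0 : ℝ) 1, invCdf μ u = H (L u)) :
    GeomBdd (recordMean H) ↔ GeomBdd fun n : ℕ => (∫ y, y ^ n ∂phi μ) / n.factorial := by
  have hC : 0 < recordMean H 1 - recordMean H 0 := sub_pos.2 (recordMean_lt hH hinv)
  simp_rw [moment_phi_div_factorial hH hinv]
  constructor
  · intro h
    obtain ⟨M, b, hM, hb, h⟩ := h.diff
    refine ⟨M / (recordMean H 1 - recordMean H 0), b, by positivity, hb, fun n => ?_⟩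
    rw [abs_div, abs_of_pos hC, div_mul_eq_mul_div]
    exact div_le_div_of_nonneg_right (h n) hC.le
  · rintro ⟨M, b, hM, hb, h⟩
    refine GeomBdd.of_diff
      ⟨M * (recordMean H 1 - recordMean H 0), b, by positivity, hb, fun n => ?_⟩
    have h1 := h n
    rw [abs_div, abs_of_pos hC, div_le_iff₀ hC, abs_mul,
      abs_of_nonneg (by positivity : (0 : ℝ) ≤ (n : ℝ) + 1)] at h1
    have h2 : |recordMean H (n + 1) - recordMean H n| ≤
        ((n : ℝ) + 1) * |recordMean H (n + 1) - recordMean H n| :=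
      le_mul_of_one_le_left (abs_nonneg _) (by linarith [Nat.cast_nonneg (α := ℝ) n])
    linarith

lemma exists_integrable_exp_phi_iff (hH : MemHStar H)
    (hinv : ∀ u ∈ Ioo (0 : ℝ) 1, invCdf μ u = H (L u)) :
    (∃ a : ℝ, 0 < a ∧ Integrable (fun x => Real.exp (a * x)) (phi μ)) ↔
      GeomBdd (recordMean H) := by
  rw [geomBdd_recordMean_iff_moment hH hinv]
  constructor
  · rintro ⟨a, ha, h⟩
    exact GeomBdd.of_summable ha ((integrable_exp_phi_iff_summable hH hinv ha.le).1 h)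
  · intro h
    obtain ⟨ε, hε, h⟩ := h.summable
    refine ⟨ε / 2, half_pos hε, (integrable_exp_phi_iff_summable hH hinv (half_pos hε).le).2 ?_⟩
    exact (h (ε / 2) (by rw [abs_of_pos (half_pos hε)]; exact half_lt_self hε)).of_abs

lemma exists_summable_abs_iff (hH : MemHStar H) :
    (∃ t : ℝ, 0 < t ∧ Summable fun n => recordAbsMean H n * t ^ n) ↔
      GeomBdd (recordMean H) := by
  rw [geomBdd_recordMean_iff hH]
  constructor
  · rintro ⟨a, ha, h⟩
    exact GeomBdd.of_summable ha h
  · intro h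
    obtain ⟨ε, hε, h⟩ := h.summable
    exact ⟨ε / 2, half_pos hε, (h (ε / 2) (by
      rw [abs_of_pos (half_pos hε)]; exact half_lt_self hε)).of_abs⟩

lemma exists_summable_iff :
    (∃ ε : ℝ, 0 < ε ∧ ∀ t : ℝ, |t| < ε → Summable fun n => recordMean H n * t ^ n) ↔
      GeomBdd (recordMean H) := by
  constructor
  · rintro ⟨ε, hε, h⟩
    exact GeomBdd.of_summable (half_pos hε) (h (ε / 2) (by
      rw [abs_of_pos (half_pos hε)]; exact half_lt_self hε))
  · intro h
    obtain ⟨ε, hε, h⟩ := h.summable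
    exact ⟨ε, hε, fun t ht => (h t ht).of_abs⟩

lemma summable_abs_iff_integrable (hH : MemHStar H) {t : ℝ} (ht : 0 ≤ t) :
    (Summable fun n => recordAbsMean H n * t ^ n) ↔
      IntegrableOn (fun y => Real.exp (t * y) * (Real.exp (-y) * |H y|)) (Ioi 0) := by
  have := integrable_exp_mul_iff_summable (ν := volume.restrict (Ioi 0))
    (f := fun y => Real.exp (-y) * |H y|) (ae_restrict_mem measurableSet_Ioi)
    (fun y => by positivity) (fun n => by simpa [mul_assoc, IntegrableOn] using hH.integrable n) ht
  rw [IntegrableOn, this]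
  refine summable_congr fun n => ?_
  rw [recordAbsMean, ← integral_const_mul, ← integral_mul_const]
  congr 1
  ext y
  ring

lemma integrableOn_exp_neg_half : IntegrableOn (fun y : ℝ => Real.exp (-(1 / 2) * y)) (Ioi 0) :=
  integrableOn_exp_mul_Ioi (by norm_num) 0

/-- Young's inequality for the product of the positive part of `H` and `e^{ty}`. -/
lemma integrableOn_exp_of_rpow (hH : MemHStar H) {p : ℝ} (hp : 1 < p)
    (h : IntegrableOn (fun y => Real.exp (-y) * max (H y) 0 ^ p) (Ioi 0)) :
    ∃ t : ℝ, 0 < t ∧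
      IntegrableOn (fun y => Real.exp (t * y) * (Real.exp (-y) * |H y|)) (Ioi 0) := by
  have hpq := Real.HolderConjugate.conjExponent hp
  set q := p.conjExponent with hq
  have hq1 : 1 < q := hpq.symm.lt
  have hq0 : 0 < q := by linarith
  -- Chosen so that `(e^{ty})^q = e^{y/2}`, which is integrable against `e^{-y}`.
  refine ⟨(2 * q)⁻¹, by positivity, ?_⟩
  set t := (2 * q)⁻¹ with ht
  have ht0 : 0 < t := by positivity
  have htq : t * q = 1 / 2 := by rw [ht]; field_simp
  have hthalf : t ≤ 1 / 2 := by rw [← htq]; exact le_mul_of_one_le_right ht0.le hq1.le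
  have hi0 : IntegrableOn (fun y => Real.exp (-y) * |H y|) (Ioi 0) := by
    simpa using hH.integrable 0
  -- In this dominating function the first term serves `(0, 1]`, the other two serve `[1, ∞)`.
  have hb := ((hi0.const_mul (Real.exp 1)).add h).add
    (integrableOn_exp_neg_half.const_mul (1 + |H 1|))
  refine Integrable.mono' hb ?_ ?_
  · exact (by fun_prop : Measurable fun y : ℝ => Real.exp (t * y)).aestronglyMeasurable.mul
      hi0.aestronglyMeasurable
  · filter_upwards [ae_restrict_mem measurableSet_Ioi] with y hy
    have hy' : (0 : ℝ) < y := hy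
    have hmax : 0 ≤ max (H y) 0 := le_max_right _ _
    have hmp : 0 ≤ max (H y) 0 ^ p := Real.rpow_nonneg hmax _
    rw [Real.norm_of_nonneg (by positivity)]
    simp only [Pi.add_apply]
    rcases le_total 1 y with h1 | h1
    · have h2 := hH.abs_le_of_one_le h1
      have h3 : max (H y) 0 * Real.exp (t * y) ≤ max (H y) 0 ^ p + Real.exp (1 / 2 * y) := by
        refine (Real.young_inequality_of_nonneg hmax (Real.exp_pos (t * y)).le hpq).trans ?_
        rw [← Real.exp_mul, show t * y * q = 1 / 2 * y by rw [← htq]; ring]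
        exact add_le_add (div_le_self hmp hp.le) (div_le_self (Real.exp_pos _).le hq1.le)
      have h4 : Real.exp (t * y) ≤ Real.exp (1 / 2 * y) := Real.exp_le_exp.2 (by nlinarith)
      have h5 : Real.exp (t * y) * |H y| ≤
          max (H y) 0 ^ p + (1 + |H 1|) * Real.exp (1 / 2 * y) := by
        have h6 := mul_le_mul_of_nonneg_left h2 (Real.exp_pos (t * y)).le
        have h7 := mul_le_mul_of_nonneg_right h4 (abs_nonneg (H 1))
        linarith
      have h8 := mul_le_mul_of_nonneg_left h5 (Real.exp_pos (-y)).le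
      have h9 : Real.exp (-y) * Real.exp (1 / 2 * y) = Real.exp (-(1 / 2) * y) := by
        rw [← Real.exp_add]; ring_nf
      have h10 : 0 ≤ Real.exp 1 * (Real.exp (-y) * |H y|) := by positivity
      rw [← h9]
      linarith
    · have h2 : Real.exp (t * y) ≤ Real.exp 1 := Real.exp_le_exp.2 (by nlinarith)
      have h3 := mul_le_mul_of_nonneg_right h2 (by positivity : 0 ≤ Real.exp (-y) * |H y|)
      have h4 : 0 ≤ Real.exp (-y) * max (H y) 0 ^ p := by positivity
      have h5 : 0 ≤ (1 + |H 1|) * Real.exp (-(1 / 2) * y) := by positivity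
      linarith

/-- Monotonicity turns the integral bound into the pointwise bound `H⁺(y) ≤ K e^{(1-t)y}`. Then
`(H⁺)^{1+t} ≤ |H| (K e^{(1-t)y})^t`, and `t (1-t) ≤ t`. -/
lemma rpow_integrableOn_of_exp (hH : MemHStar H) {t : ℝ} (ht0 : 0 < t)
    (h : IntegrableOn (fun y => Real.exp (t * y) * (Real.exp (-y) * |H y|)) (Ioi 0)) :
    ∃ p : ℝ, 1 < p ∧ IntegrableOn (fun y => Real.exp (-y) * max (H y) 0 ^ p) (Ioi 0) := by
  -- With `1 - t ≥ 0` the weight `e^{-(1-t)z}` is nonincreasing, as the comparison on `(y, y+1]`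
  -- requires.
  wlog ht1 : t ≤ 1 generalizing t
  · refine this one_pos ?_ le_rfl
    refine Integrable.mono' h ?_ ?_
    · have hi0 : IntegrableOn (fun y => Real.exp (-y) * |H y|) (Ioi 0) := by
        simpa using hH.integrable 0
      exact (by fun_prop : Measurable fun y : ℝ => Real.exp (1 * y)).aestronglyMeasurable.mul
        hi0.aestronglyMeasurable
    · filter_upwards [ae_restrict_mem measurableSet_Ioi] with y hy
      have hy' : (0 : ℝ) < y := hy
      rw [Real.norm_of_nonneg (by positivity)]
      refine mul_le_mul_of_nonneg_right (Real.exp_le_exp.2 ?_) (by positivity)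
      nlinarith
  set I := ∫ y in Ioi (0 : ℝ), Real.exp (t * y) * (Real.exp (-y) * |H y|) with hI
  have hI0 : 0 ≤ I := setIntegral_nonneg measurableSet_Ioi fun y _ => by positivity
  have hgrow : ∀ y, 0 < y → max (H y) 0 ≤ I * Real.exp (1 - t) * Real.exp ((1 - t) * y) := by
    intro y hy
    rcases le_total (H y) 0 with hneg | hpos
    · rw [max_eq_right hneg]; positivity
    rw [max_eq_left hpos]
    -- On `(y, y+1]` the function `H` is at least `H y`, and the weight is at least its value at `y
    -- + 1`.
    have h1 : ∫ z in Ioc y (y + 1), Real.exp (-(1 - t) * (y + 1)) * H y ≤ I := by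
      refine (setIntegral_mono_on (integrableOn_const (by simp)) (h.mono_set fun z hz =>
        hy.trans hz.1) measurableSet_Ioc fun z hz => ?_).trans (setIntegral_mono_set h
          ((ae_restrict_mem measurableSet_Ioi).mono fun z _ => by
            simp only [Pi.zero_apply]; positivity)
          (LE.le.eventuallyLE fun z hz => hy.trans hz.1))
      rw [← mul_assoc, ← Real.exp_add]
      have h2 : H y ≤ |H z| :=
        (hH.mono hy (mem_Ioi.2 (hy.trans hz.1)) hz.1.le).trans (le_abs_self _)
      refine mul_le_mul (Real.exp_le_exp.2 ?_) h2 hpos (Real.exp_pos _).le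
      nlinarith [hz.2]
    rw [setIntegral_const, measureReal_def, Real.volume_Ioc] at h1
    simp only [add_sub_cancel_left, ENNReal.ofReal_one, ENNReal.toReal_one, one_smul] at h1
    have h3 : H y = Real.exp ((1 - t) * (y + 1)) * (Real.exp (-(1 - t) * (y + 1)) * H y) := by
      rw [← mul_assoc, ← Real.exp_add, show (1 - t) * (y + 1) + -(1 - t) * (y + 1) = 0 by ring,
        Real.exp_zero, one_mul]
    rw [h3, mul_assoc, ← Real.exp_add, show 1 - t + (1 - t) * y = (1 - t) * (y + 1) by ring,
      mul_comm I]
    exact mul_le_mul_of_nonneg_left h1 (Real.exp_pos _).le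
  set K := I * Real.exp (1 - t) with hK
  have hK0 : 0 ≤ K := by positivity
  refine ⟨1 + t, by linarith, ?_⟩
  refine Integrable.mono' (h.const_mul (K ^ t)) ?_ ?_
  · have : AEMeasurable (fun y => max (H y) 0 ^ (1 + t)) (volume.restrict (Ioi 0)) :=
      (hH.aemeasurable_restrict.max aemeasurable_const).pow_const _
    exact ((by fun_prop : Measurable fun y : ℝ => Real.exp (-y)).aemeasurable.mul
      this).aestronglyMeasurable
  · filter_upwards [ae_restrict_mem measurableSet_Ioi] with y hy
    have hy' : (0 : ℝ) < y := hy
    have hmax : 0 ≤ max (H y) 0 := le_max_right _ _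
    have hmp : 0 ≤ max (H y) 0 ^ (1 + t) := Real.rpow_nonneg hmax _
    rw [Real.norm_of_nonneg (by positivity)]
    have h1 : max (H y) 0 ^ (1 + t) = max (H y) 0 * max (H y) 0 ^ t := by
      rw [Real.rpow_add_of_nonneg hmax zero_le_one ht0.le, Real.rpow_one]
    have h2 : max (H y) 0 ^ t ≤ K ^ t * Real.exp (t * y) := by
      refine (Real.rpow_le_rpow hmax (hgrow y hy') ht0.le).trans ?_
      rw [Real.mul_rpow hK0 (Real.exp_pos _).le, ← Real.exp_mul]
      refine mul_le_mul_of_nonneg_left (Real.exp_le_exp.2 ?_) (Real.rpow_nonneg hK0 _)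
      nlinarith [mul_pos ht0 hy', mul_pos (mul_pos ht0 hy') ht0]
    have h3 : max (H y) 0 ≤ |H y| := max_le (le_abs_self _) (abs_nonneg _)
    rw [h1]
    have h4 := mul_le_mul h3 h2 (Real.rpow_nonneg hmax _) (abs_nonneg (H y))
    have h5 := mul_le_mul_of_nonneg_left h4 (Real.exp_pos (-y)).le
    linarith

theorem exists_rpow_integrable_iff (hH : MemHStar H) :
    (∃ p : ℝ, 1 < p ∧ IntegrableOn (fun y => Real.exp (-y) * max (H y) 0 ^ p) (Ioi 0)) ↔
      GeomBdd (recordMean H) := by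
  rw [← exists_summable_abs_iff hH]
  constructor
  · rintro ⟨p, hp, h⟩
    obtain ⟨t, ht, h⟩ := integrableOn_exp_of_rpow hH hp h
    exact ⟨t, ht, (summable_abs_iff_integrable hH ht.le).2 h⟩
  · rintro ⟨t, ht, h⟩
    exact rpow_integrableOn_of_exp hH ht ((summable_abs_iff_integrable hH ht.le).1 h)

end

/-! ### Uniqueness from generating functions near zero. -/

lemma Ioo_subset_interior_integrableExpSet {ν : Measure ℝ} {ε : ℝ}
    (h : ∀ t : ℝ, |t| < ε → Integrable (fun x => Real.exp (t * x)) ν) :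
    Ioo (-ε) ε ⊆ interior (integrableExpSet id ν) :=
  interior_maximal (fun t ht => h t (abs_lt.2 ht)) isOpen_Ioo

/-- A law is determined by its moment generating function near zero. -/
theorem measure_ext_of_mgf_eventuallyEq {ν₁ ν₂ : Measure ℝ} [IsFiniteMeasure ν₁]
    [IsFiniteMeasure ν₂]
    (h₁ : ∀ᶠ t in 𝓝 (0 : ℝ), Integrable (fun x => Real.exp (t * x)) ν₁)
    (h₂ : ∀ᶠ t in 𝓝 (0 : ℝ), Integrable (fun x => Real.exp (t * x)) ν₂)
    (h : ∀ᶠ t in 𝓝 (0 : ℝ), mgf id ν₁ t = mgf id ν₂ t) : ν₁ = ν₂ := by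
  obtain ⟨ε, hε, hall⟩ := Metric.eventually_nhds_iff.1 (h₁.and (h₂.and h))
  simp only [Real.dist_eq, sub_zero] at hall
  have s₁ := Ioo_subset_interior_integrableExpSet fun t ht => (hall ht).1
  have s₂ := Ioo_subset_interior_integrableExpSet fun t ht => (hall ht).2.1
  -- Both complex moment generating functions are analytic on this vertical strip and agree on a
  -- real interval around 0. The identity theorem carries equality to the imaginary axis, where they
  -- are the characteristic functions.
  set U : Set ℂ := {z | z.re ∈ Ioo (-ε) ε} with hU
  have hUconv : Convex ℝ U := (convex_Ioo (-ε) ε).linear_preimage Complex.reLm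
  have hreal : ∃ᶠ z in 𝓝[≠] (0 : ℂ), complexMGF id ν₁ z = complexMGF id ν₂ z := by
    have h0 : ∃ᶠ x : ℝ in 𝓝[≠] 0, complexMGF id ν₁ x = complexMGF id ν₂ x := by
      refine Eventually.frequently ((h.filter_mono nhdsWithin_le_nhds).mono fun t ht => ?_)
      rw [complexMGF_ofReal, complexMGF_ofReal, ht]
    have ht : Tendsto (fun x : ℝ => (x : ℂ)) (𝓝[≠] 0) (𝓝[≠] 0) := by
      refine tendsto_nhdsWithin_iff.2 ⟨?_, ?_⟩
      · have : Tendsto (fun x : ℝ => (x : ℂ)) (𝓝 0) (𝓝 0) := by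
          simpa using Complex.continuous_ofReal.tendsto 0
        exact this.mono_left nhdsWithin_le_nhds
      · filter_upwards [self_mem_nhdsWithin] with x hx
        simpa using hx
    exact ht.frequently h0
  have heq : EqOn (complexMGF id ν₁) (complexMGF id ν₂) U :=
    AnalyticOnNhd.eqOn_of_preconnected_of_frequently_eq
      (analyticOnNhd_complexMGF.mono fun z hz => s₁ hz)
      (analyticOnNhd_complexMGF.mono fun z hz => s₂ hz) hUconv.isPreconnected
      (z₀ := 0) (by simp [hU, hε]) hreal
  refine Measure.ext_of_charFun ?_
  ext t
  rw [← complexMGF_id_mul_I, ← complexMGF_id_mul_I]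
  exact heq (by simp [hU, hε])

lemma eq_of_eventually_genFun_eq {a b : ℕ → ℝ}
    (ha : ∀ᶠ t in 𝓝 (0 : ℝ), Summable fun n => a n * t ^ n)
    (hb : ∀ᶠ t in 𝓝 (0 : ℝ), Summable fun n => b n * t ^ n)
    (h : ∀ᶠ t in 𝓝 (0 : ℝ), genFun a t = genFun b t) : a = b := by
  have key : ∀ c : ℕ → ℝ, (∀ᶠ t in 𝓝 (0 : ℝ), Summable fun n => c n * t ^ n) →
      HasFPowerSeriesAt (genFun c) (FormalMultilinearSeries.ofScalars ℝ c) 0 := by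
    intro c hc
    rw [hasFPowerSeriesAt_iff]
    filter_upwards [hc] with t ht
    simp only [FormalMultilinearSeries.coeff_ofScalars, smul_eq_mul, zero_add]
    have := ht.hasSum
    simp_rw [mul_comm] at this ⊢
    convert! this using 1
  have h1 := ((key a ha).congr h).eq_formalMultilinearSeries (key b hb)
  exact FormalMultilinearSeries.ofScalars_series_injective (𝕜 := ℝ) ℝ h1

/-! ### The generating function of the expected records. -/

section

variable {μ : Measure ℝ} {H : ℝ → ℝ}

lemma integrable_exp_phi_of_le {a t : ℝ} (hta : t ≤ a)
    (h : Integrable (fun x => Real.exp (a * x)) (phi μ)) :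
    Integrable (fun x => Real.exp (t * x)) (phi μ) := by
  refine Integrable.mono' h (by fun_prop) ?_
  filter_upwards [phi_ae_pos μ] with y hy
  rw [Real.norm_of_nonneg (Real.exp_pos _).le]
  exact Real.exp_le_exp.2 (by nlinarith)

lemma moment_phi_nonneg (μ : Measure ℝ) (n : ℕ) : 0 ≤ ∫ y, y ^ n ∂phi μ :=
  integral_nonneg_of_ae ((phi_ae_pos μ).mono fun _ hy => pow_nonneg (le_of_lt hy) n)

/-- The power series of the moment generating function of `φ(X)`. -/
theorem hasSum_mgf_phi (hH : MemHStar H)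
    (hinv : ∀ u ∈ Ioo (0 : ℝ) 1, invCdf μ u = H (L u)) {t : ℝ}
    (h : Integrable (fun x => Real.exp (|t| * x)) (phi μ)) :
    HasSum (fun n : ℕ => (∫ y, y ^ n ∂phi μ) / n.factorial * t ^ n) (mgf id (phi μ) t) := by
  have hs := (integrable_exp_phi_iff_summable hH hinv (abs_nonneg t)).1 h
  have hi : ∀ n : ℕ, Integrable (fun y => (t * y) ^ n / n.factorial) (phi μ) := by
    intro n
    refine ((integrable_pow_phi hH hinv n).const_mul (t ^ n / n.factorial)).congr ?_
    exact ae_of_all _ fun y => by simp only [mul_pow]; ring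
  have hn : ∀ n : ℕ, ∫ y, ‖(t * y) ^ n / n.factorial‖ ∂phi μ =
      (∫ y, y ^ n ∂phi μ) / n.factorial * |t| ^ n := by
    intro n
    rw [← integral_div, ← integral_mul_const]
    refine integral_congr_ae ?_
    filter_upwards [phi_ae_pos μ] with y hy
    rw [Real.norm_eq_abs, abs_div, abs_pow, abs_mul, abs_of_pos hy, Nat.abs_cast, mul_pow]
    ring
  have := hasSum_integral_of_summable_integral_norm hi (by simpa only [hn] using hs)
  have e1 : ∀ n : ℕ, ∫ y, (t * y) ^ n / n.factorial ∂phi μ =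
      (∫ y, y ^ n ∂phi μ) / n.factorial * t ^ n := by
    intro n
    rw [← integral_div, ← integral_mul_const]
    congr 1
    ext y
    rw [mul_pow]; ring
  have e2 : ∀ y : ℝ, ∑' n : ℕ, (t * y) ^ n / n.factorial = Real.exp (t * y) := by
    intro y
    rw [Real.exp_eq_exp_ℝ]
    exact (NormedSpace.expSeries_div_hasSum_exp (t * y)).tsum_eq
  simp only [e1, e2] at this
  exact this

/-- The moments of `φ(X)` depend only on the normalized increments of the expected records, and
geometric growth makes the moments determine the law. This gives both `φ(φ⁻¹(T)) = T` and the
uniqueness of `X`. -/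
theorem phi_eq_of_recordMean {μ' : Measure ℝ} {H' : ℝ → ℝ} (hH : MemHStar H)
    (hinv : ∀ u ∈ Ioo (0 : ℝ) 1, invCdf μ u = H (L u)) (hH' : MemHStar H')
    (hinv' : ∀ u ∈ Ioo (0 : ℝ) 1, invCdf μ' u = H' (L u)) (hg : GeomBdd (recordMean H))
    (hrec : ∀ n, (recordMean H' (n + 1) - recordMean H' n) / (recordMean H' 1 - recordMean H' 0) =
      (recordMean H (n + 1) - recordMean H n) / (recordMean H 1 - recordMean H 0)) :
    phi μ' = phi μ := by
  have := isProbabilityMeasure_phi hH hinv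
  have := isProbabilityMeasure_phi hH' hinv'
  have hmom : ∀ n : ℕ, ∫ y, y ^ n ∂phi μ' = ∫ y, y ^ n ∂phi μ := by
    intro n
    rw [integral_pow_phi hH hinv, integral_pow_phi hH' hinv', mul_div_assoc, mul_div_assoc, hrec]
  obtain ⟨a, ha, hia⟩ := (exists_integrable_exp_phi_iff hH hinv).2 hg
  have hia' : Integrable (fun x => Real.exp (a * x)) (phi μ') := by
    rw [integrable_exp_phi_iff_summable hH' hinv' ha.le]
    simp only [hmom]
    exact (integrable_exp_phi_iff_summable hH hinv ha.le).1 hia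
  have hev : ∀ᶠ t in 𝓝 (0 : ℝ), |t| < a := by
    have := continuous_abs.tendsto (0 : ℝ)
    rw [abs_zero] at this
    exact this.eventually_lt_const ha
  refine measure_ext_of_mgf_eventuallyEq ?_ ?_ ?_
  · filter_upwards [hev] with t ht using
      integrable_exp_phi_of_le ((le_abs_self t).trans ht.le) hia'
  · filter_upwards [hev] with t ht using
      integrable_exp_phi_of_le ((le_abs_self t).trans ht.le) hia
  · filter_upwards [hev] with t ht
    have h1 := hasSum_mgf_phi hH hinv (integrable_exp_phi_of_le ht.le hia)
    have h2 := hasSum_mgf_phi hH' hinv' (integrable_exp_phi_of_le ht.le hia')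
    simp only [hmom] at h2
    exact h2.unique h1

lemma continuousAt_mgf_phi {a : ℝ} (h : Integrable (fun x => Real.exp (a * x)) (phi μ)) {t : ℝ}
    (ht : |t| < a) : ContinuousAt (mgf id (phi μ)) t := by
  have s := Ioo_subset_interior_integrableExpSet (ν := phi μ) (ε := a) fun s hs =>
    integrable_exp_phi_of_le ((le_abs_self s).trans hs.le) h
  exact (differentiableAt_mgf (s (abs_lt.1 ht))).continuousAt

lemma intervalIntegrable_mgf_phi {a : ℝ} (h : Integrable (fun x => Real.exp (a * x)) (phi μ))
    {t : ℝ} (ht : |t| < a) : IntervalIntegrable (mgf id (phi μ)) volume 0 t := by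
  refine ContinuousOn.intervalIntegrable fun s hs => ?_
  refine (continuousAt_mgf_phi h ?_).continuousWithinAt
  have h1 : |s| ≤ |t| := by
    rcases le_total 0 t with h0 | h0
    · rw [uIcc_of_le h0] at hs
      rw [abs_of_nonneg hs.1, abs_of_nonneg h0]; exact hs.2
    · rw [uIcc_of_ge h0] at hs
      rw [abs_of_nonpos hs.2, abs_of_nonpos h0]; linarith [hs.1]
  exact h1.trans_lt ht

/-- Termwise integration, dominated by the series at `|t|`. The factor `n + 1` in the moments
cancels against the integral of `s^n`. -/
lemma hasSum_integral_mgf_phi (hH : MemHStar H)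
    (hinv : ∀ u ∈ Ioo (0 : ℝ) 1, invCdf μ u = H (L u)) {t : ℝ}
    (h : Integrable (fun x => Real.exp (|t| * x)) (phi μ)) :
    HasSum (fun n : ℕ => (recordMean H (n + 1) - recordMean H n) * t ^ (n + 1))
      ((recordMean H 1 - recordMean H 0) * ∫ s in (0 : ℝ)..t, mgf id (phi μ) s) := by
  have hC : recordMean H 1 - recordMean H 0 ≠ 0 := (sub_pos.2 (recordMean_lt hH hinv)).ne'
  have hs := (integrable_exp_phi_iff_summable hH hinv (abs_nonneg t)).1 h
  have habs : ∀ s ∈ uIoc 0 t, |s| ≤ |t| := by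
    intro s hs
    rcases le_total 0 t with h0 | h0
    · rw [uIoc_of_le h0] at hs
      rw [abs_of_pos hs.1, abs_of_nonneg h0]; exact hs.2
    · rw [uIoc_of_ge h0] at hs
      rw [abs_of_nonpos hs.2, abs_of_nonpos h0]; linarith [hs.1]
  have key := intervalIntegral.hasSum_integral_of_dominated_convergence (μ := volume)
    (a := 0) (b := t) (F := fun (n : ℕ) s => (∫ y, y ^ n ∂phi μ) / n.factorial * s ^ n)
    (f := mgf id (phi μ))
    (fun (n : ℕ) _ => (∫ y, y ^ n ∂phi μ) / n.factorial * |t| ^ n)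
    (fun n => by fun_prop)
    (fun n => ae_of_all _ fun s hs => by
      have h0 := moment_phi_nonneg μ n
      rw [Real.norm_eq_abs, abs_mul, abs_pow, abs_of_nonneg (by positivity)]
      exact mul_le_mul_of_nonneg_left (pow_le_pow_left₀ (abs_nonneg s) (habs s hs) n)
        (by positivity))
    (ae_of_all _ fun s _ => hs) intervalIntegrable_const
    (ae_of_all _ fun s hs => hasSum_mgf_phi hH hinv (integrable_exp_phi_of_le (habs s hs) h))
  refine (key.mul_left (recordMean H 1 - recordMean H 0)).congr_fun fun n => ?_
  rw [intervalIntegral.integral_const_mul, integral_pow, moment_phi_div_factorial hH hinv]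
  have : (n : ℝ) + 1 ≠ 0 := by positivity
  rw [zero_pow (by omega), sub_zero]
  field_simp

/-- The generating function of the expected records in terms of the law of `φ(X)`. -/
theorem one_sub_mul_genFun (hH : MemHStar H)
    (hinv : ∀ u ∈ Ioo (0 : ℝ) 1, invCdf μ u = H (L u)) {t : ℝ}
    (h : Integrable (fun x => Real.exp (|t| * x)) (phi μ))
    (hs : Summable fun n => recordMean H n * t ^ n) :
    (1 - t) * genFun (recordMean H) t = recordMean H 0 +
      (recordMean H 1 - recordMean H 0) * ∫ s in (0 : ℝ)..t, mgf id (phi μ) s := by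
  rw [← (hasSum_integral_mgf_phi hH hinv h).tsum_eq]
  have h1 : Summable fun n => recordMean H (n + 1) * t ^ (n + 1) :=
    (summable_nat_add_iff 1 (f := fun n => recordMean H n * t ^ n)).2 hs
  have h2 : Summable fun n => recordMean H n * t ^ (n + 1) :=
    (hs.mul_left t).congr fun n => by ring
  have h3 : genFun (recordMean H) t = recordMean H 0 + ∑' n, recordMean H (n + 1) * t ^ (n + 1) := by
    rw [genFun, hs.tsum_eq_zero_add]; simp
  have h4 : t * genFun (recordMean H) t = ∑' n, recordMean H n * t ^ (n + 1) := by
    rw [genFun, ← tsum_mul_left]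
    exact tsum_congr fun n => by ring
  have h5 : ∀ n, (recordMean H (n + 1) - recordMean H n) * t ^ (n + 1) =
      recordMean H (n + 1) * t ^ (n + 1) - recordMean H n * t ^ (n + 1) := fun n => by ring
  simp_rw [h5]
  rw [h1.tsum_sub h2, sub_mul, one_mul, h4, h3]
  ring

lemma exists_generating_radius (hH : MemHStar H)
    (hinv : ∀ u ∈ Ioo (0 : ℝ) 1, invCdf μ u = H (L u)) (hg : GeomBdd (recordMean H)) :
    ∃ ε : ℝ, 0 < ε ∧ ε < 1 ∧ Integrable (fun x => Real.exp (ε * x)) (phi μ) ∧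
      ∀ t : ℝ, |t| < ε → Summable fun n => recordMean H n * t ^ n := by
  obtain ⟨a, ha, hia⟩ := (exists_integrable_exp_phi_iff hH hinv).2 hg
  obtain ⟨ε, hε, hs⟩ := exists_summable_iff.2 hg
  refine ⟨min (min a ε) (1 / 2), by positivity, (min_le_right _ _).trans_lt (by norm_num),
    integrable_exp_phi_of_le ((min_le_left _ _).trans (min_le_left _ _)) hia, fun t ht => ?_⟩
  exact hs t (ht.trans_le ((min_le_left _ _).trans (min_le_right _ _)))

theorem hasDerivAt_one_sub_mul_genFun (hH : MemHStar H)
    (hinv : ∀ u ∈ Ioo (0 : ℝ) 1, invCdf μ u = H (L u)) {ε : ℝ}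
    (hi : Integrable (fun x => Real.exp (ε * x)) (phi μ))
    (hs : ∀ t : ℝ, |t| < ε → Summable fun n => recordMean H n * t ^ n) {t : ℝ} (ht : |t| < ε) :
    HasDerivAt (fun s => (1 - s) * genFun (recordMean H) s)
      ((recordMean H 1 - recordMean H 0) * mgf id (phi μ) t) t := by
  have hev : ∀ᶠ s in 𝓝 t, |s| < ε := continuous_abs.continuousAt.eventually_lt_const ht
  have heq : (fun s => (1 - s) * genFun (recordMean H) s) =ᶠ[𝓝 t] fun s => recordMean H 0 +
      (recordMean H 1 - recordMean H 0) * ∫ x in (0 : ℝ)..s, mgf id (phi μ) x := by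
    filter_upwards [hev] with s hs'
    exact one_sub_mul_genFun hH hinv (integrable_exp_phi_of_le hs'.le hi) (hs s hs')
  have hmeas : StronglyMeasurableAtFilter (mgf id (phi μ)) (𝓝 t) volume :=
    ContinuousAt.stronglyMeasurableAtFilter (isOpen_lt continuous_abs continuous_const)
      (fun s hs' => continuousAt_mgf_phi hi hs') t ht
  have := intervalIntegral.integral_hasDerivAt_right (intervalIntegrable_mgf_phi hi ht) hmeas
    (continuousAt_mgf_phi hi ht)
  exact ((this.const_mul _).const_add _).congr_of_eventuallyEq heq

end

/-! ### The inversion formula. -/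

lemma hasDerivAt_exp_div {x : ℝ} (hx : x ≠ 0) :
    HasDerivAt (fun x => Real.exp x / x) ((x - 1) / x ^ 2 * Real.exp x) x := by
  refine ((Real.hasDerivAt_exp x).div (hasDerivAt_id x) hx).congr_deriv ?_
  simp only [id]
  field_simp

lemma continuousOn_deriv_exp_div :
    ContinuousOn (fun x : ℝ => (x - 1) / x ^ 2 * Real.exp x) (Ioi 0) := by
  intro x hx
  have hx' : x ^ 2 ≠ 0 := pow_ne_zero 2 (ne_of_gt hx)
  exact ((by fun_prop : ContinuousAt (fun x : ℝ => x - 1) x).div (continuousAt_id.pow 2) hx' |>.mul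
    Real.continuous_exp.continuousAt).continuousWithinAt

lemma uIcc_subset_Ioi_zero {a b : ℝ} (ha : 0 < a) (hb : 0 < b) : uIcc a b ⊆ Ioi 0 :=
  fun _ hx => (lt_min ha hb).trans_le hx.1

lemma intervalIntegrable_deriv_mul_cdf (ν : Measure ℝ) {a b : ℝ} (ha : 0 < a) (hb : 0 < b) :
    IntervalIntegrable (fun x => (x - 1) / x ^ 2 * Real.exp x * cdf ν x) volume a b :=
  ((monotone_cdf ν).monotoneOn _).intervalIntegrable.continuousOn_mul
    (continuousOn_deriv_exp_div.mono (uIcc_subset_Ioi_zero ha hb))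

lemma integral_deriv_exp_div {a b : ℝ} (ha : 0 < a) (hb : 0 < b) :
    ∫ x in a..b, (x - 1) / x ^ 2 * Real.exp x = Real.exp b / b - Real.exp a / a :=
  intervalIntegral.integral_eq_sub_of_hasDerivAt
    (fun _ hx => hasDerivAt_exp_div (ne_of_gt (uIcc_subset_Ioi_zero ha hb hx)))
    (continuousOn_deriv_exp_div.mono (uIcc_subset_Ioi_zero ha hb)).intervalIntegrable

/-- Integration by parts for `e^x / x` against `ν`, by Fubini on `{z ≤ x}`. Atoms are allowed, hence
the open half-lines in the boundary terms and the half-open interval. -/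
lemma integral_deriv_mul_cdf (ν : Measure ℝ) [IsProbabilityMeasure ν] {a b : ℝ} (ha : 0 < a)
    (hab : a ≤ b) :
    ∫ x in a..b, (x - 1) / x ^ 2 * Real.exp x * cdf ν x =
      Real.exp b / b * ν.real (Iio b) - Real.exp a / a * ν.real (Iio a) -
        ∫ x in Ico a b, Real.exp x / x ∂ν := by
  have hb : 0 < b := ha.trans_le hab
  set k' : ℝ → ℝ := fun x => (x - 1) / x ^ 2 * Real.exp x with hk'
  have hk'i : IntegrableOn k' (Ioc a b) :=
    (intervalIntegrable_iff_integrableOn_Ioc_of_le hab).1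
      (continuousOn_deriv_exp_div.mono (uIcc_subset_Ioi_zero ha hb)).intervalIntegrable
  let D : Set (ℝ × ℝ) := {p | p.1 ≤ p.2}
  have hD : MeasurableSet D := measurableSet_le measurable_fst measurable_snd
  have hint : Integrable (D.indicator fun p => k' p.2) (ν.prod (volume.restrict (Ioc a b))) :=
    (hk'i.comp_snd ν).indicator hD
  have hsec : ∀ x, ∫ z, D.indicator (fun p => k' p.2) (z, x) ∂ν = k' x * cdf ν x := by
    intro x
    have : ∀ z, D.indicator (fun p => k' p.2) (z, x) = (Iic x).indicator (fun _ => k' x) z :=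
      fun z => rfl
    simp_rw [this]
    rw [integral_indicator measurableSet_Iic, setIntegral_const, cdf_eq_real, smul_eq_mul, mul_comm]
  -- The derivative of `e^x / x` is integrated over the part of `(a, b]` from `z` on. The indicators
  -- distinguish `z < a`, `a ≤ z < b` and `z ≥ b`.
  have hother : ∀ z, ∫ x in Ioc a b, D.indicator (fun p => k' p.2) (z, x) =
      (Iio b).indicator (fun _ => Real.exp b / b) z - (Iio a).indicator (fun _ => Real.exp a / a) z -
        (Ico a b).indicator (fun x => Real.exp x / x) z := by
    intro z
    have : ∀ x, D.indicator (fun p => k' p.2) (z, x) = (Ici z).indicator k' x := fun x => rfl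
    simp_rw [this]
    rw [integral_indicator measurableSet_Ici, Measure.restrict_restrict measurableSet_Ici]
    rcases lt_or_ge z a with hza | haz
    · have h1 : Ici z ∩ Ioc a b = Ioc a b := inter_eq_right.2 fun x hx => hza.le.trans hx.1.le
      rw [h1, ← intervalIntegral.integral_of_le hab, integral_deriv_exp_div ha hb,
        indicator_of_mem (show z ∈ Iio b from hza.trans_le hab),
        indicator_of_mem (show z ∈ Iio a from hza),
        indicator_of_notMem (fun h : z ∈ Ico a b => not_lt.2 h.1 hza), sub_zero]
    · rw [indicator_of_notMem (show z ∉ Iio a from not_lt.2 haz), sub_zero]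
      rcases lt_or_ge z b with hzb | hbz
      · have h1 : (Ici z ∩ Ioc a b : Set ℝ) =ᵐ[volume] Ioc z b := by
          have h2 : (Ici z : Set ℝ) =ᵐ[volume] Ioi z := Ioi_ae_eq_Ici.symm
          refine (h2.inter (ae_eq_refl _)).trans (Eq.eventuallyEq ?_)
          ext x
          exact ⟨fun h => ⟨h.1, h.2.2⟩, fun h => ⟨h.1, haz.trans_lt h.1, h.2⟩⟩
        rw [setIntegral_congr_set h1, ← intervalIntegral.integral_of_le hzb.le,
          integral_deriv_exp_div (ha.trans_le haz) hb, indicator_of_mem (show z ∈ Iio b from hzb),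
          indicator_of_mem (show z ∈ Ico a b from ⟨haz, hzb⟩)]
      · have h1 : volume (Ici z ∩ Ioc a b : Set ℝ) = 0 := by
          refine measure_mono_null (t := {b}) (fun x hx => ?_) (by simp)
          exact le_antisymm hx.2.2 (hbz.trans hx.1)
        rw [setIntegral_measure_zero _ h1, indicator_of_notMem (show z ∉ Iio b from not_lt.2 hbz),
          indicator_of_notMem (fun h : z ∈ Ico a b => not_lt.2 hbz h.2), sub_zero]
  have hswap := integral_integral_swap
    (f := fun z x => D.indicator (fun p => k' p.2) (z, x)) hint
  have hIco : IntegrableOn (fun x => Real.exp x / x) (Ico a b) ν := by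
    have hc : ContinuousOn (fun x => Real.exp x / x) (Icc a b) := fun x hx =>
      (hasDerivAt_exp_div (ne_of_gt (ha.trans_le hx.1))).continuousAt.continuousWithinAt
    exact hc.integrableOn_Icc.mono_set Ico_subset_Icc_self
  have i1 : ∀ (c r : ℝ), Integrable ((Iio c).indicator fun _ => r) ν := fun c r =>
    (integrable_const r).indicator measurableSet_Iio
  have i2 : ∀ (c r : ℝ), ∫ z, (Iio c).indicator (fun _ => r) z ∂ν = r * ν.real (Iio c) := by
    intro c r
    rw [integral_indicator measurableSet_Iio, setIntegral_const, smul_eq_mul, mul_comm]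
  simp only [hsec, hother] at hswap
  have i3 : Integrable (fun z => (Iio b).indicator (fun _ => Real.exp b / b) z -
      (Iio a).indicator (fun _ => Real.exp a / a) z) ν := (i1 _ _).sub (i1 _ _)
  rw [integral_sub i3 (hIco.integrable_indicator measurableSet_Ico),
    integral_sub (i1 _ _) (i1 _ _), i2, i2, integral_indicator measurableSet_Ico] at hswap
  rw [intervalIntegral.integral_of_le hab, hswap]

/-- The increments of the function in the inversion formula. -/
theorem preH_sub_preH (ν : Measure ℝ) [IsProbabilityMeasure ν] {a b : ℝ} (ha : 0 < a)
    (hab : a ≤ b) : preH ν b - preH ν a = ∫ x in Ico a b, Real.exp x / x ∂ν := by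
  have hb : 0 < b := ha.trans_le hab
  have h1 := intervalIntegral.integral_interval_sub_left
    (intervalIntegrable_deriv_mul_cdf ν one_pos hb) (intervalIntegrable_deriv_mul_cdf ν one_pos ha)
  have h2 := integral_deriv_mul_cdf ν ha hab
  rw [preH, preH]
  linarith

section

variable {μ : Measure ℝ} {H : ℝ → ℝ}

lemma recordMean_zero (H : ℝ → ℝ) :
    recordMean H 0 = ∫ y in Ioi (0 : ℝ), Real.exp (-y) * H y := by
  simp [recordMean]

lemma recordMean_one (H : ℝ → ℝ) :
    recordMean H 1 = ∫ y in Ioi (0 : ℝ), y * Real.exp (-y) * H y := by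
  simp [recordMean]

/-- The inversion formula. -/
theorem invH_phi (hH : MemHStar H)
    (hinv : ∀ u ∈ Ioo (0 : ℝ) 1, invCdf μ u = H (L u)) {y : ℝ} (hy : 0 < y) :
    invH (phi μ) y = (H y - recordMean H 0) / (recordMean H 1 - recordMean H 0) := by
  have := isProbabilityMeasure_phi hH hinv
  set C := recordMean H 1 - recordMean H 0 with hC
  have hC0 : C ≠ 0 := (sub_pos.2 (recordMean_lt hH hinv)).ne'
  -- `preH` and `H / C` have equal increments, so they differ by a constant. Subtracting the
  -- exponential mean `cConst` removes it.
  have hpre : ∀ z, 0 < z → preH (phi μ) z = H z / C + (preH (phi μ) 1 - H 1 / C) := by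
    intro z hz
    rcases le_total 1 z with h | h
    · have h1 := preH_sub_preH (phi μ) one_pos h
      have h2 := sub_eq_setIntegral_phi hH hinv one_pos h
      rw [← h1, ← hC] at h2
      field_simp
      linarith
    · have h1 := preH_sub_preH (phi μ) hz h
      have h2 := sub_eq_setIntegral_phi hH hinv hz h
      rw [← h1, ← hC] at h2
      field_simp
      linarith
  have hi : IntegrableOn (fun y => Real.exp (-y) * H y) (Ioi 0) := by
    simpa using hH.integrableOn_mul 0
  have hi1 : IntegrableOn (fun y : ℝ => Real.exp (-y)) (Ioi 0) := by
    simpa using integrableOn_pow_mul_exp_neg 0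
  have hone : ∫ y in Ioi (0 : ℝ), Real.exp (-y) = 1 := by
    simpa using integral_pow_mul_exp_neg 0
  have hc : cConst (phi μ) = recordMean H 0 / C + (preH (phi μ) 1 - H 1 / C) := by
    have e : ∀ y ∈ Ioi (0 : ℝ), Real.exp (-y) * preH (phi μ) y =
        Real.exp (-y) * H y / C + Real.exp (-y) * (preH (phi μ) 1 - H 1 / C) := by
      intro y hy
      rw [hpre y hy]; ring
    rw [cConst, setIntegral_congr_fun measurableSet_Ioi e,
      integral_add (hi.div_const _) (hi1.mul_const _), integral_div, integral_mul_const, hone,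
      recordMean_zero, one_mul]
  rw [invH, hpre y hy, hc]
  ring

lemma recordMean_affine (hH : MemHStar H) (c d : ℝ) (n : ℕ) :
    recordMean (fun y => (H y - c) / d) n = (recordMean H n - c) / d := by
  have hone : ∫ y in Ioi (0 : ℝ), y ^ n * Real.exp (-y) / n.factorial = 1 := by
    rw [integral_div, integral_pow_mul_exp_neg, div_self (by positivity)]
  have i1 := hH.integrableOn_div_mul n
  have i2 := (integrableOn_pow_mul_exp_neg n).div_const (n.factorial : ℝ)
  have e : ∀ y : ℝ, y ^ n * Real.exp (-y) / n.factorial * ((H y - c) / d) =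
      (y ^ n * Real.exp (-y) / n.factorial * H y - y ^ n * Real.exp (-y) / n.factorial * c) / d :=
    fun y => by ring
  rw [recordMean]
  simp_rw [e]
  rw [integral_div, integral_sub i1 (i2.mul_const _), integral_mul_const, hone, one_mul]
  rfl

lemma MemHStar.affine (hH : MemHStar H) (c : ℝ) {d : ℝ} (hd : 0 < d) :
    MemHStar fun y => (H y - c) / d := by
  refine ⟨?_, ?_, ?_, ?_⟩
  · obtain ⟨x, hx, y, hy, hne⟩ := hH.nonconst
    refine ⟨x, hx, y, hy, fun h => hne ?_⟩
    have := (div_left_inj' hd.ne').1 h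
    linarith
  · intro x hx y hy hxy
    exact div_le_div_of_nonneg_right (sub_le_sub_right (hH.mono hx hy hxy) c) hd.le
  · intro y hy
    exact ((hH.leftCont y hy).sub continuousWithinAt_const).div_const d
  · intro m
    have i1 := hH.integrableOn_mul m
    have i2 := integrableOn_pow_mul_exp_neg m
    refine ((i1.sub (i2.mul_const c)).div_const d).abs.congr ?_
    filter_upwards [ae_restrict_mem measurableSet_Ioi] with y hy
    have hy' : (0 : ℝ) < y := hy
    have : 0 ≤ y ^ m * Real.exp (-y) := by positivity
    rw [← abs_of_nonneg this, ← abs_mul]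
    simp only [Pi.sub_apply]
    congr 1
    ring

/-- The standardized function belongs to `H₀`. -/
lemma MemHStar.memHZero (hH : MemHStar H) (hlt : recordMean H 0 < recordMean H 1) :
    MemHZero fun y => (H y - recordMean H 0) / (recordMean H 1 - recordMean H 0) := by
  have h0 := recordMean_affine hH (recordMean H 0) (recordMean H 1 - recordMean H 0) 0
  have h1 := recordMean_affine hH (recordMean H 0) (recordMean H 1 - recordMean H 0) 1
  rw [sub_self, zero_div, recordMean_zero] at h0
  rw [div_self (sub_pos.2 hlt).ne'] at h1
  refine ⟨hH.affine _ (sub_pos.2 hlt), h0, ?_⟩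
  exact (recordMean_one _).symm.trans h1

lemma invCdf_map_affine [IsProbabilityMeasure μ] (c : ℝ) {d : ℝ} (hd : 0 < d) {u : ℝ}
    (hu : u ∈ Ioo (0 : ℝ) 1) :
    invCdf (μ.map fun x => (x - c) / d) u = (invCdf μ u - c) / d := by
  have hm : Measurable fun x : ℝ => (x - c) / d := by fun_prop
  have : IsProbabilityMeasure (μ.map fun x => (x - c) / d) :=
    Measure.isProbabilityMeasure_map hm.aemeasurable
  have h : {x : ℝ | u ≤ cdf (μ.map fun x => (x - c) / d) x} = Ici ((invCdf μ u - c) / d) := by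
    ext x
    have h1 : (fun x => (x - c) / d) ⁻¹' Iic x = Iic (x * d + c) := by
      ext z
      rw [mem_preimage, mem_Iic, mem_Iic, div_le_iff₀ hd, sub_le_iff_le_add]
    rw [mem_ofPred_eq, cdf_eq_real, map_measureReal_apply hm measurableSet_Iic, h1, ← cdf_eq_real,
      ← invCdf_le_iff hu, mem_Ici, div_le_iff₀ hd, sub_le_iff_le_add]
  rw [invCdf, h, csInf_Ici]

/-- Both sides are images of the uniform law, under functions that agree on `(0, 1)` by `invH_phi`.
-/
lemma phiInv_phi [IsProbabilityMeasure μ] (hH : MemHStar H)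
    (hinv : ∀ u ∈ Ioo (0 : ℝ) 1, invCdf μ u = H (L u)) :
    phiInv (phi μ) =
      μ.map fun x => (x - recordMean H 0) / (recordMean H 1 - recordMean H 0) := by
  have hm : AEMeasurable H (unifLaw.map L) := unifLaw_map_L ▸ hH.aemeasurable_gammaLaw 0
  have hμ : μ = unifLaw.map (H ∘ L) := by
    rw [← AEMeasurable.map_map_of_aemeasurable hm measurable_L.aemeasurable, unifLaw_map_L]
    exact eq_map_gammaLaw hH hinv
  have hg : Measurable fun x => (x - recordMean H 0) / (recordMean H 1 - recordMean H 0) := by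
    fun_prop
  conv_rhs => rw [hμ, AEMeasurable.map_map_of_aemeasurable hg.aemeasurable
    (hm.comp_measurable measurable_L)]
  refine Measure.map_congr ?_
  filter_upwards [ae_restrict_mem measurableSet_Ioo] with u hu
  exact invH_phi hH hinv (L_pos hu)

lemma map_phiInv_phi [IsProbabilityMeasure μ] (hH : MemHStar H)
    (hinv : ∀ u ∈ Ioo (0 : ℝ) 1, invCdf μ u = H (L u)) :
    μ = (phiInv (phi μ)).map
      fun x => recordMean H 0 + (recordMean H 1 - recordMean H 0) * x := by
  have hC0 : recordMean H 1 - recordMean H 0 ≠ 0 := (sub_pos.2 (recordMean_lt hH hinv)).ne'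
  rw [phiInv_phi hH hinv, Measure.map_map (by fun_prop) (by fun_prop)]
  convert! Measure.map_id.symm using 2
  ext x
  simp only [Function.comp, id]
  field_simp
  ring

end

end RecordSeq

/-! ### The theorem. -/

theorem mainTheorem5
    -- a random variable `X` whose law belongs to `H*`
    {Ω : Type*} [MeasurableSpace Ω] (P : Measure Ω) [IsProbabilityMeasure P]
    (X : Ω → ℝ) (hX : Measurable X) (hXH : LawHStar (P.map X))
    -- an i.i.d. sequence of uniform random variables, which yields the uniform records
    {S : Type*} [MeasurableSpace S] (Q : Measure S) [IsProbabilityMeasure Q]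
    (Y : ℕ → S → ℝ) (hYm : ∀ i, Measurable (Y i)) (hYi : iIndepFun Y Q)
    (hYu : ∀ i, pdf.IsUniform (Y i) (Ioo (0 : ℝ) 1) Q volume)
    -- `ρ n` is `ρ_{n+1}`, `w n` is `w_{n+1}`, and `τ` is the law of `T = φ(X)`
    (ρ : ℕ → ℝ) (hρ : ρ = expRecord (P.map X) Y Q)
    (w : ℕ → ℝ) (hw : w = absRecord (P.map X) Y Q)
    (τ : Measure ℝ) (hτ : τ = phi (P.map X)) :
    -- everything is well-defined
    (∀ n, Integrable (record (P.map X) Y n) Q) ∧ ρ 0 < ρ 1 ∧ LawT τ ∧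
    -- the equivalences
    List.TFAE
      [∃ p : ℝ, 1 < p ∧ Integrable (fun ω => (max (X ω) 0) ^ p) P,
       ∃ ε : ℝ, 0 < ε ∧ ∀ t : ℝ, |t| < ε → Summable (fun n => ρ n * t ^ n),
       ∃ t : ℝ, 0 < t ∧ Summable (fun n => w n * t ^ n),
       ∃ a : ℝ, 0 < a ∧ Integrable (fun x => Real.exp (a * x)) τ] ∧
    -- the consequences of (any of) the four conditions
    ((∃ p : ℝ, 1 < p ∧ Integrable (fun ω => (max (X ω) 0) ^ p) P) →
      -- the formula for the generating function and the one for the moment generating function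
      (∃ ε : ℝ, 0 < ε ∧ ε < 1 ∧ ∀ t : ℝ, |t| < ε →
        Summable (fun n => ρ n * t ^ n) ∧
        Integrable (fun x => Real.exp (t * x)) τ ∧
        IntervalIntegrable (fun s => mgf id τ s) volume 0 t ∧
        genFun ρ t = 1 / (1 - t) * (ρ 0 + (ρ 1 - ρ 0) * ∫ s in (0 : ℝ)..t, mgf id τ s) ∧
        DifferentiableAt ℝ (fun s => (1 - s) * genFun ρ s) t ∧
        mgf id τ t = 1 / (ρ 1 - ρ 0) * deriv (fun s => (1 - s) * genFun ρ s) t) ∧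
      -- `φ'(T)` is the element of `H₀` with inverse distribution function `u ↦ H₀(L(u))`,
      -- `φ` takes it back to `T`, and `X = ρ₁ + (ρ₂ - ρ₁) φ'(T)` in law
      (LawHZero (phiInv τ) ∧ (∀ u ∈ Ioo (0 : ℝ) 1, invCdf (phiInv τ) u = invH τ (L u)) ∧
        phi (phiInv τ) = τ ∧
        P.map X = (phiInv τ).map (fun x => ρ 0 + (ρ 1 - ρ 0) * x)) ∧
      -- `T` is the only element of its class whose moment generating function is the one
      -- obtained from `G_ρ`, so that `X` is recovered from any such element
      (∀ ν : Measure ℝ, LawT ν →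
        (∀ᶠ t in 𝓝 (0 : ℝ), Integrable (fun x => Real.exp (t * x)) ν ∧
          mgf id ν t = 1 / (ρ 1 - ρ 0) * deriv (fun s => (1 - s) * genFun ρ s) t) →
        ν = τ ∧ P.map X = (phiInv ν).map (fun x => ρ 0 + (ρ 1 - ρ 0) * x)) ∧
      -- `X` is characterized by the generating function of its expected record sequence
      (∀ μ' : Measure ℝ, LawHStar μ' →
        (∀ᶠ t in 𝓝 (0 : ℝ), Summable (fun n => expRecord μ' Y Q n * t ^ n) ∧
          genFun (expRecord μ' Y Q) t = genFun ρ t) →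
        μ' = P.map X)) := by
  obtain ⟨hprob, H, hH, hinv⟩ := hXH
  subst hρ hw hτ
  have hYl : ∀ i, Q.map (Y i) = unifLaw := fun i => map_eq_unifLaw_of_isUniform (hYu i)
  have hρ : expRecord (P.map X) Y Q = recordMean H :=
    funext fun n => expRecord_eq hYm hYi hYl hH hinv n
  have hw : absRecord (P.map X) Y Q = recordAbsMean H :=
    funext fun n => absRecord_eq hYm hYi hYl hH hinv n
  have hT := lawT_phi hH hinv
  have hTp := hT.prob
  rw [hρ, hw]
  have hC : 0 < recordMean H 1 - recordMean H 0 := sub_pos.2 (recordMean_lt hH hinv)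
  -- The law of `X` is the image of the exponential law under `H`, so condition (i) becomes a
  -- condition on `H`.
  have hp : ∀ p : ℝ, Integrable (fun ω => (max (X ω) 0) ^ p) P ↔
      IntegrableOn (fun y => Real.exp (-y) * max (H y) 0 ^ p) (Ioi 0) := by
    intro p
    have hm : Measurable fun x : ℝ => max x 0 ^ p := by fun_prop
    have h1 := integrable_map_measure (f := X) (μ := P) (g := fun x : ℝ => max x 0 ^ p)
      hm.aestronglyMeasurable hX.aemeasurable
    have h2 := integrable_map_measure (f := H) (μ := gammaLaw 0) (g := fun x : ℝ => max x 0 ^ p)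
      hm.aestronglyMeasurable (hH.aemeasurable_gammaLaw 0)
    rw [← eq_map_gammaLaw hH hinv, h1, integrable_gammaLaw_iff] at h2
    simpa [Function.comp_def] using h2
  have hi : (∃ p : ℝ, 1 < p ∧ Integrable (fun ω => (max (X ω) 0) ^ p) P) ↔
      GeomBdd (recordMean H) := by
    simp only [hp]
    exact exists_rpow_integrable_iff hH
  refine ⟨integrable_record hYm hYi hYl hH hinv, recordMean_lt hH hinv, hT, ?_, ?_⟩
  · tfae_have 1 ↔ 2 := hi.trans exists_summable_iff.symm
    tfae_have 3 ↔ 2 := (exists_summable_abs_iff hH).trans exists_summable_iff.symm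
    tfae_have 4 ↔ 2 := (exists_integrable_exp_phi_iff hH hinv).trans exists_summable_iff.symm
    tfae_finish
  intro hcond
  have hg := hi.1 hcond
  obtain ⟨ε, hε, hε1, hiε, hs⟩ := exists_generating_radius hH hinv hg
  have hev : ∀ᶠ t in 𝓝 (0 : ℝ), |t| < ε := by
    have := continuous_abs.tendsto (0 : ℝ)
    rw [abs_zero] at this
    exact this.eventually_lt_const hε
  have hmgf : ∀ t : ℝ, |t| < ε → mgf id (phi (P.map X)) t = 1 / (recordMean H 1 - recordMean H 0) *
      deriv (fun s => (1 - s) * genFun (recordMean H) s) t := by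
    intro t ht
    rw [(hasDerivAt_one_sub_mul_genFun hH hinv hiε hs ht).deriv]
    field_simp
  have hpI : phiInv (phi (P.map X)) =
      (P.map X).map fun x => (x - recordMean H 0) / (recordMean H 1 - recordMean H 0) :=
    phiInv_phi hH hinv
  have hpIprob : IsProbabilityMeasure (phiInv (phi (P.map X))) := by
    rw [hpI]
    exact Measure.isProbabilityMeasure_map (by fun_prop)
  have hZ := hH.memHZero (recordMean_lt hH hinv)
  have hZinv : ∀ u ∈ Ioo (0 : ℝ) 1, invCdf (phiInv (phi (P.map X))) u =
      (H (L u) - recordMean H 0) / (recordMean H 1 - recordMean H 0) := by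
    intro u hu
    rw [hpI, invCdf_map_affine _ hC hu, hinv u hu]
  have hback := map_phiInv_phi hH hinv
  refine ⟨⟨ε, hε, hε1, fun t ht => ?_⟩, ⟨⟨hpIprob, _, hZ, hZinv⟩, ?_, ?_, hback⟩, ?_, ?_⟩
  · have hit := integrable_exp_phi_of_le (μ := P.map X) ht.le hiε
    refine ⟨hs t ht, integrable_exp_phi_of_le ((le_abs_self t).trans ht.le) hiε,
      intervalIntegrable_mgf_phi hiε ht, ?_,
      (hasDerivAt_one_sub_mul_genFun hH hinv hiε hs ht).differentiableAt, hmgf t ht⟩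
    have h1t : 1 - t ≠ 0 := (by linarith [le_abs_self t] : 0 < 1 - t).ne'
    rw [← one_sub_mul_genFun hH hinv hit (hs t ht)]
    field_simp
  · intro u hu
    rw [hZinv u hu, invH_phi hH hinv (L_pos hu)]
  -- Normalized increments of the expected records are invariant under positive affine maps.
  · refine phi_eq_of_recordMean hH hinv hZ.toMemHStar hZinv hg fun n => ?_
    simp only [recordMean_affine hH]
    rw [← sub_div, ← sub_div, sub_sub_sub_cancel_right, sub_sub_sub_cancel_right,
      div_div_div_cancel_right₀ hC.ne']
  · intro ν hν hνm
    have hνp := hν.prob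
    have : ν = phi (P.map X) := by
      refine measure_ext_of_mgf_eventuallyEq (hνm.mono fun t ht => ht.1) ?_ ?_
      · filter_upwards [hev] with t ht using
          integrable_exp_phi_of_le ((le_abs_self t).trans ht.le) hiε
      · filter_upwards [hev, hνm] with t ht ht'
        rw [ht'.2, hmgf t ht]
    exact ⟨this, this ▸ hback⟩
  · intro μ' hμ' hgen
    obtain ⟨hprob', H', hH', hinv'⟩ := hμ'
    have hρ' : expRecord μ' Y Q = recordMean H' :=
      funext fun n => expRecord_eq hYm hYi hYl hH' hinv' n
    rw [hρ'] at hgen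
    -- All coefficients agree, in particular `ρ_1` and `ρ_2`, so the same affine map recovers both
    -- laws from the common `φ`-image.
    have hrec : recordMean H' = recordMean H :=
      eq_of_eventually_genFun_eq (hgen.mono fun t ht => ht.1)
        (hev.mono fun t ht => hs t ht) (hgen.mono fun t ht => ht.2)
    have hphi : phi μ' = phi (P.map X) :=
      phi_eq_of_recordMean hH hinv hH' hinv' hg fun n => by rw [hrec]
    rw [hback, map_phiInv_phi hH' hinv', hphi, hrec]
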